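/- For a $C^*$-algebra $A$ let $\tilde A=\mathbb C\mathbb 1\oplus A$ be its unitization (a unit $\mathbb 1$ is adjoined even if $A$ already has one). Let $K_0(A)=\ker\bigl(K_0(\tilde A)\to K_0(\mathbb C)\bigr)$, where $K_0$ of a unital algebra is the Grothendieck group of the monoid of Murray–von Neumann classes of projections in matrix algebras over it, and let $K_1(A)$ be the group of stable homotopy classes of unitary matrices over $\tilde A$; a $*$-homomorphism $\varphi$ induces $\varphi_*$ on $K_0$. Let $q\mathbb C=\{f\in C_0((0,1],M_2(\mathbb C)) : f(1)\text{ is diagonal}\}$, with elements $h_0=t\otimes e_{11}$, $k_0=t\otimes e_{22}$, $x_0=\sqrt{t-t^2}\otimes e_{21}$. Then $$P_0=\begin{pmatrix}\mathbb 1-h_0 & x_0^*\\ x_0 & k_0\end{pmatrix}\in M_2(\widetilde{q\mathbb C})$$ is a projection; put $b=[P_0]-[\mathbb 1]\in K_0(q\mathbb C)$. For a short exact sequence of $C^*$-algebras and $*$-homomorphisms $0\to I\to A\xrightarrow{\pi} B\to 0$, let $\partial:K_0(B)\to K_1(I)$ be the exponential (boundary) map: for projections $p,q$ in matrix algebras over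 $\tilde B$ with $[p]-[q]\in K_0(B)$, and self-adjoint lifts $a,c$ of $p,q$ to matrices over $\tilde A$, $\partial([p]-[q])=[e^{2\pi i a}]-[e^{2\pi i c}]$, where $e^{2\pi ia}$ and $e^{2\pi ic}$ are regarded as unitary matrices over $\tilde I\subseteq\tilde A$. **Theorem.** Let $0\to I\to A\xrightarrow{\pi} B\to 0$ be a short exact sequence of $C^*$-algebras. If $x\in K_0(B)$ satisfies $x=\varphi_*(b)$ for some $*$-homomorphism $\varphi:q\mathbb C\to B$, then there is a unitary $u\in\tilde I$ (a single element, i.e. a $1\times1$ matrix over $\tilde I$) such that $\partial(x)=[u]$ in $K_1(I)$. -/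

import Mathlib

open scoped Matrix

set_option linter.unusedSectionVars false

namespace CStarK

section Corner

variable {R : Type*} [Ring R] [StarRing R]
variable {ι κ μ : Type*} [Fintype ι] [DecidableEq ι] [Fintype κ] [DecidableEq κ]
  [Fintype μ] [DecidableEq μ]

/-- The 0-1 matrix of a map `f : ι → κ` of index sets, sending the basis vector `e_i` to
`e_{f i}`. -/
def inclMat (R : Type*) [Ring R] (f : ι → κ) : Matrix κ ι R :=
  (1 : Matrix κ κ R).submatrix id f

theorem inclMat_apply (f : ι → κ) (i : κ) (j : ι) :
    inclMat R f i j = if i = f j then 1 else 0 := by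
  simp [inclMat, Matrix.one_apply]

theorem inclMat_comp (f : ι → κ) (g : κ → μ) :
    inclMat R g * inclMat R f = inclMat R (g ∘ f) := by
  ext i j
  simp [Matrix.mul_apply, inclMat_apply]

theorem inclMat_isometry {f : ι → κ} (hf : Function.Injective f) :
    (inclMat R f)ᴴ * inclMat R f = 1 := by
  ext i j
  simp [Matrix.mul_apply, inclMat_apply, Matrix.one_apply, hf.eq_iff, apply_ite star, eq_comm]

theorem inclMat_orthogonal {f : ι → κ} {g : μ → κ} (h : ∀ i j, f i ≠ g j) :
    (inclMat R f)ᴴ * inclMat R g = 0 := by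
  ext i j
  simp only [Matrix.mul_apply, inclMat_apply, Matrix.conjTranspose_apply, Matrix.zero_apply]
  apply Finset.sum_eq_zero
  intro k _
  by_cases hk : k = f i
  · subst hk; simp [h]
  · simp [hk]

theorem conj_mul {S : Matrix κ ι R} (hS : Sᴴ * S = 1) (x y : Matrix ι ι R) :
    (S * x * Sᴴ) * (S * y * Sᴴ) = S * (x * y) * Sᴴ := by
  calc (S * x * Sᴴ) * (S * y * Sᴴ) = S * x * (Sᴴ * S) * y * Sᴴ := by simp only [Matrix.mul_assoc]
    _ = _ := by rw [hS, Matrix.mul_one, Matrix.mul_assoc S x y]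

/-- The matrix `1 + S (x - 1) Sᴴ` for an isometry `S`: it acts as `x` on the range of `S` and as
the identity on the orthogonal complement. -/
def cornerMat (S : Matrix κ ι R) (x : Matrix ι ι R) : Matrix κ κ R := 1 + S * (x - 1) * Sᴴ

theorem cornerMat_one (S : Matrix κ ι R) : cornerMat S 1 = 1 := by simp [cornerMat]

theorem cornerMat_star (S : Matrix κ ι R) (x : Matrix ι ι R) :
    star (cornerMat S x) = cornerMat S (star x) := by
  simp [cornerMat, Matrix.star_eq_conjTranspose, Matrix.conjTranspose_mul, Matrix.mul_assoc]

theorem cornerMat_mul {S : Matrix κ ι R} (hS : Sᴴ * S = 1) (x y : Matrix ι ι R) :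
    cornerMat S x * cornerMat S y = cornerMat S (x * y) := by
  have h1 : x * y - 1 = (x - 1) + (y - 1) + (x - 1) * (y - 1) := by
    rw [sub_mul, mul_sub, one_mul, mul_one]; abel
  have h2 : S * (x * y - 1) * Sᴴ = S * (x - 1) * Sᴴ + S * (y - 1) * Sᴴ
      + S * (x - 1) * Sᴴ * (S * (y - 1) * Sᴴ) := by
    rw [conj_mul hS, h1, Matrix.mul_add, Matrix.mul_add, Matrix.add_mul, Matrix.add_mul]
  unfold cornerMat
  rw [h2]
  generalize S * (x - 1) * Sᴴ = a
  generalize S * (y - 1) * Sᴴ = b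
  simp only [mul_add, add_mul, mul_one, one_mul]
  abel

/-- The unitary `1 + S (u - 1) Sᴴ` obtained from a unitary `u` and an isometry `S`. -/
def corner (S : Matrix κ ι R) (hS : Sᴴ * S = 1) :
    unitary (Matrix ι ι R) →* unitary (Matrix κ κ R) where
  toFun u := ⟨cornerMat S u, by
    rw [Unitary.mem_iff, cornerMat_star, cornerMat_mul hS, cornerMat_mul hS,
      Unitary.star_mul_self_of_mem u.2, Unitary.mul_star_self_of_mem u.2, cornerMat_one]
    exact ⟨rfl, rfl⟩⟩
  map_one' := Subtype.ext (cornerMat_one S)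
  map_mul' u v := Subtype.ext (cornerMat_mul hS _ _).symm

theorem corner_coe (S : Matrix κ ι R) (hS : Sᴴ * S = 1) (u : unitary (Matrix ι ι R)) :
    (corner S hS u : Matrix κ κ R) = cornerMat S u := rfl

theorem corner_corner (S : Matrix κ ι R) (hS : Sᴴ * S = 1) (T : Matrix μ κ R) (hT : Tᴴ * T = 1)
    (hTS : (T * S)ᴴ * (T * S) = 1) (u : unitary (Matrix ι ι R)) :
    corner T hT (corner S hS u) = corner (T * S) hTS u := by
  apply Subtype.ext
  simp [corner_coe, cornerMat, Matrix.conjTranspose_mul, Matrix.mul_assoc]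

theorem continuous_corner [TopologicalSpace R] [IsTopologicalRing R]
    (S : Matrix κ ι R) (hS : Sᴴ * S = 1) : Continuous (corner S hS) := by
  apply Continuous.subtype_mk
  have : Continuous fun u : unitary (Matrix ι ι R) => (u : Matrix ι ι R) := continuous_subtype_val
  unfold cornerMat
  fun_prop

/-- The embedding `u ↦ u ⊕ 1_{k-n}` of the unitary group of size `n` into that of size `k ≥ n`. -/
def pad {n k : ℕ} (h : n ≤ k) :
    unitary (Matrix (Fin n) (Fin n) R) →* unitary (Matrix (Fin k) (Fin k) R) :=
  corner (inclMat R (Fin.castLE h)) (inclMat_isometry (Fin.castLE_injective h))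

/-- `pad h u` is the block diagonal matrix with blocks `u` and the identity. -/
theorem pad_apply {n k : ℕ} (h : n ≤ k) (u : unitary (Matrix (Fin n) (Fin n) R)) (i j : Fin k) :
    (pad h u : Matrix (Fin k) (Fin k) R) i j =
      if hij : (i : ℕ) < n ∧ (j : ℕ) < n then (u : Matrix (Fin n) (Fin n) R) ⟨i, hij.1⟩ ⟨j, hij.2⟩
      else if i = j then 1 else 0 := by
  have e : ∀ (i : Fin k) (a : Fin n), i = Fin.castLE h a ↔ (i : ℕ) = a := fun i a => Fin.ext_iff
  rw [pad, corner_coe, cornerMat]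
  simp only [Matrix.add_apply, Matrix.mul_apply, inclMat_apply, Matrix.conjTranspose_apply, e,
    apply_ite star, star_one, star_zero, ite_mul, one_mul, zero_mul, mul_ite, mul_one, mul_zero]
  by_cases hj : (j : ℕ) < n
  · rw [Finset.sum_eq_single ⟨j, hj⟩ (by
      intro b _ hb; rw [if_neg]; intro h'; exact hb (Fin.ext h'.symm)) (by simp)]
    by_cases hi : (i : ℕ) < n
    · rw [Finset.sum_eq_single ⟨i, hi⟩ (by
        intro b _ hb; rw [if_neg]; intro h'; exact hb (Fin.ext h'.symm)) (by simp)]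
      simp [hi, hj, Matrix.one_apply, Fin.ext_iff]
    · rw [Finset.sum_eq_zero (by intro b _; rw [if_neg]; omega)]
      simp [hi, Matrix.one_apply]
  · rw [Finset.sum_eq_zero (by intro b _; rw [if_neg]; omega)]
    simp [hj, Matrix.one_apply]

theorem pad_pad {n k m : ℕ} (h : n ≤ k) (h' : k ≤ m) (u : unitary (Matrix (Fin n) (Fin n) R)) :
    pad h' (pad h u) = pad (h.trans h') u := by
  have hc : (Fin.castLE h') ∘ (Fin.castLE h) = Fin.castLE (h.trans h') := rfl
  unfold pad
  rw [corner_corner _ _ _ _ (by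
    rw [inclMat_comp, hc]; exact inclMat_isometry (Fin.castLE_injective _))]
  congr 1
  simp only [inclMat_comp, hc]

theorem pad_self {n : ℕ} (h : n ≤ n) (u : unitary (Matrix (Fin n) (Fin n) R)) : pad h u = u := by
  apply Subtype.ext
  ext i j
  simp [pad_apply]

theorem continuous_pad [TopologicalSpace R] [IsTopologicalRing R] {n k : ℕ} (h : n ≤ k) :
    Continuous (pad (R := R) h) :=
  continuous_corner _ _

end Corner

section Rotation

variable {𝔐 : Type*} [Ring 𝔐] [StarRing 𝔐] [Algebra ℂ 𝔐] [StarModule ℂ 𝔐]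

theorem one_add_smul_mem_unitary {e : 𝔐} (he : IsStarProjection e) {z : ℂ}
    (hz : star z * z = 1) : 1 + (z - 1) • e ∈ unitary 𝔐 := by
  have hs : star (1 + (z - 1) • e) = 1 + (star z - 1) • e := by
    simp [he.isSelfAdjoint.star_eq, star_smul]
  have key : ∀ a b : ℂ, a * b = 1 → (1 + (a - 1) • e) * (1 + (b - 1) • e) = 1 := by
    intro a b hab
    have h2 : (a - 1) • e * ((b - 1) • e) = ((a - 1) * (b - 1)) • e := by
      rw [smul_mul_smul_comm, he.isIdempotentElem.eq]
    rw [mul_add, add_mul (1 : 𝔐) _ ((b - 1) • e), h2, mul_one, one_mul, add_assoc, ← add_smul,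
      ← add_smul]
    have : a - 1 + (b - 1 + (a - 1) * (b - 1)) = 0 := by linear_combination hab
    rw [this, zero_smul, add_zero]
  rw [Unitary.mem_iff, hs]
  exact ⟨key _ _ hz, key _ _ (by rw [mul_comm]; exact hz)⟩

theorem joined_one_reflection [TopologicalSpace 𝔐] [IsTopologicalRing 𝔐] [ContinuousSMul ℂ 𝔐]
    {e : 𝔐} (he : IsStarProjection e) {W : unitary 𝔐} (hW : (W : 𝔐) = 1 - (2 : ℂ) • e) :
    Joined 1 W := by
  have hz : ∀ t : ℝ, star (Complex.exp (Real.pi * t * Complex.I))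
      * Complex.exp (Real.pi * t * Complex.I) = 1 := by
    intro t
    rw [Complex.star_def, ← Complex.exp_conj, ← Complex.exp_add]
    simp
  refine ⟨⟨⟨fun t => ⟨1 + (Complex.exp (Real.pi * (t : ℝ) * Complex.I) - 1) • e,
    one_add_smul_mem_unitary he (hz t)⟩, ?_⟩, ?_, ?_⟩⟩
  · apply Continuous.subtype_mk
    fun_prop
  · apply Subtype.ext; simp
  · apply Subtype.ext
    rw [hW]
    have : Complex.exp (Real.pi * ((1 : unitInterval) : ℝ) * Complex.I) = -1 := by
      simp
    simp only [this]
    rw [sub_eq_add_neg (1 : 𝔐), ← neg_smul]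
    norm_num

/-- A partial isometry `v` with orthogonal source and range projections gives the projection
`(v⋆v + vv⋆ - v - v⋆) / 2`, whose reflection exchanges the two projections. -/
theorem isStarProjection_half {v : 𝔐} (hv : v * star v * v = v) (hvv : v * v = 0) :
    IsStarProjection ((1 / 2 : ℂ) • (star v * v + v * star v - v - star v)) := by
  have hv' : star v * v * star v = star v := by
    have := congrArg star hv
    simpa [mul_assoc] using this
  have hvv' : star v * star v = 0 := by
    have := congrArg star hvv
    simpa using this
  constructor
  · rw [IsIdempotentElem, smul_mul_smul_comm]
    have : (star v * v + v * star v - v - star v) * (star v * v + v * star v - v - star v)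
        = (2 : ℂ) • (star v * v + v * star v - v - star v) := by
      have a1 : v * (star v * v) = v := by rw [← mul_assoc]; exact hv
      have a2 : star v * (v * star v) = star v := by rw [← mul_assoc]; exact hv'
      have a3 : ∀ x, v * (v * x) = 0 := fun x => by rw [← mul_assoc, hvv, zero_mul]
      have a4 : ∀ x, star v * (star v * x) = 0 := fun x => by rw [← mul_assoc, hvv', zero_mul]
      simp only [mul_add, add_mul, mul_sub, sub_mul, mul_assoc, a1, a2, a3, a4, hvv, hvv', mul_zero]
      rw [two_smul]
      abel
    rw [this, smul_smul]
    norm_num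
  · rw [IsSelfAdjoint, star_smul]
    congr 1
    · simp
    · simp
      abel

end Rotation

section Homotopy

variable {R : Type*} [Ring R] [StarRing R] [Algebra ℂ R] [StarModule ℂ R] [TopologicalSpace R]
  [IsTopologicalRing R] [ContinuousStar R] [ContinuousSMul ℂ R]
variable {ι κ μ : Type*} [Fintype ι] [DecidableEq ι] [Fintype κ] [DecidableEq κ]
  [Fintype μ] [DecidableEq μ]

theorem conj_cornerMat (W : unitary (Matrix κ κ R)) (S : Matrix κ ι R) (x : Matrix ι ι R) :
    (W : Matrix κ κ R) * cornerMat S x * star (W : Matrix κ κ R)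
      = cornerMat ((W : Matrix κ κ R) * S) x := by
  simp only [cornerMat, mul_add, add_mul, mul_one,
    Matrix.star_eq_conjTranspose, Matrix.conjTranspose_mul, Matrix.mul_assoc]
  congr 1
  exact Unitary.mul_star_self_of_mem W.2

theorem joined_corner_of_orthogonal {S T : Matrix κ ι R} (hS : Sᴴ * S = 1) (hT : Tᴴ * T = 1)
    (hST : Sᴴ * T = 0) (u : unitary (Matrix ι ι R)) :
    Joined (corner S hS u) (corner T hT u) := by
  have hTS : Tᴴ * S = 0 := by
    have := congrArg Matrix.conjTranspose hST
    simpa using this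
  set v : Matrix κ κ R := T * Sᴴ with hvdef
  have hvs : star v = S * Tᴴ := by simp [hvdef, Matrix.star_eq_conjTranspose]
  have r1 : ∀ x : Matrix ι κ R, Sᴴ * (S * x) = x := fun x => by
    rw [← Matrix.mul_assoc, hS, Matrix.one_mul]
  have r2 : ∀ x : Matrix ι κ R, Tᴴ * (T * x) = x := fun x => by
    rw [← Matrix.mul_assoc, hT, Matrix.one_mul]
  have r3 : ∀ x : Matrix ι κ R, Sᴴ * (T * x) = 0 := fun x => by
    rw [← Matrix.mul_assoc, hST, Matrix.zero_mul]
  have hv : v * star v * v = v := by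
    rw [hvs, hvdef]; simp only [Matrix.mul_assoc, r1, r2]
  have hvv : v * v = 0 := by
    rw [hvdef]; simp only [Matrix.mul_assoc, r3, Matrix.mul_zero]
  have he := isStarProjection_half hv hvv
  set e := ((1 / 2 : ℂ) • (star v * v + v * star v - v - star v)) with hedef
  have h2e : (2 : ℂ) • e = star v * v + v * star v - v - star v := by
    rw [hedef, smul_smul]; norm_num
  let W : unitary (Matrix κ κ R) := ⟨1 - (2 : ℂ) • e, by
    have := one_add_smul_mem_unitary he (z := -1) (by simp)
    convert this using 1
    rw [sub_eq_add_neg (1 : Matrix κ κ R), ← neg_smul]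
    norm_num⟩
  have hW : (W : Matrix κ κ R) = 1 - (2 : ℂ) • e := rfl
  have hJ := joined_one_reflection he hW
  have hWS : (W : Matrix κ κ R) * S = T := by
    rw [hW, h2e, hvs, hvdef]
    simp only [Matrix.sub_mul, Matrix.add_mul, Matrix.one_mul,
      Matrix.mul_assoc, hS, hTS, r1, r2, Matrix.mul_one, Matrix.mul_zero]
    abel
  have h1 : W * corner S hS u * W⁻¹ = corner T hT u := by
    apply Subtype.ext
    have := conj_cornerMat W S (u : Matrix ι ι R)
    rw [hWS] at this
    exact this
  have h2 : Joined ((1 : unitary (Matrix κ κ R)) * corner S hS u * 1⁻¹)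
      (W * corner S hS u * W⁻¹) :=
    (hJ.mul (Joined.refl _)).mul hJ.inv
  rw [h1] at h2
  simpa using h2

/-- After enlarging the matrix size, the homotopy class of `corner S u` does not depend on the
isometry `S`. -/
theorem joined_pad_corner {k n : ℕ} {S T : Matrix (Fin k) (Fin n) R} (hS : Sᴴ * S = 1)
    (hT : Tᴴ * T = 1) (u : unitary (Matrix (Fin n) (Fin n) R)) :
    Joined (pad (Nat.le_add_right k n) (corner S hS u))
      (pad (Nat.le_add_right k n) (corner T hT u)) := by
  set E := inclMat R (Fin.castLE (Nat.le_add_right k n)) with hE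
  have hEi : Eᴴ * E = 1 := inclMat_isometry (Fin.castLE_injective _)
  set Z := inclMat R (Fin.natAdd k : Fin n → Fin (k + n)) with hZ
  have hZi : Zᴴ * Z = 1 := inclMat_isometry (Fin.natAdd_injective _ _)
  have hEZ : Eᴴ * Z = 0 := inclMat_orthogonal (by
    intro i j h
    have := congrArg Fin.val h
    simp at this
    omega)
  have key : ∀ (S : Matrix (Fin k) (Fin n) R) (hS : Sᴴ * S = 1),
      Joined (pad (Nat.le_add_right k n) (corner S hS u)) (corner Z hZi u) := by
    intro S hS
    have hES : (E * S)ᴴ * (E * S) = 1 := by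
      rw [Matrix.conjTranspose_mul, Matrix.mul_assoc, ← Matrix.mul_assoc Eᴴ, hEi, Matrix.one_mul, hS]
    have : pad (Nat.le_add_right k n) (corner S hS u) = corner (E * S) hES u :=
      corner_corner _ _ _ _ _ _
    rw [this]
    apply joined_corner_of_orthogonal
    rw [Matrix.conjTranspose_mul, Matrix.mul_assoc, hEZ, Matrix.mul_zero]
  exact (key S hS).trans (key T hT).symm

end Homotopy

section K1Unital

variable (R : Type*) [Ring R] [StarRing R] [Algebra ℂ R] [StarModule ℂ R] [TopologicalSpace R]
  [IsTopologicalRing R] [ContinuousStar R] [ContinuousSMul ℂ R]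

/-- The group of unitary `n × n` matrices. -/
abbrev UMat (n : ℕ) : Type _ := unitary (Matrix (Fin n) (Fin n) R)

variable {R}

theorem joined_pad {n k : ℕ} {u v : UMat R n} (h : Joined u v) (hk : n ≤ k) :
    Joined (pad hk u) (pad hk v) :=
  h.map (continuous_pad hk)

variable (R) in
/-- Unitaries `u`, `v` of sizes `n`, `m` are identified when `u ⊕ 1` and `v ⊕ 1` are joined by a
path of unitaries in some common size `N ≥ n, m`. -/
def k1Setoid : Setoid (Σ n : ℕ, UMat R n) where
  r u v := ∃ (N : ℕ) (hu : u.1 ≤ N) (hv : v.1 ≤ N), Joined (pad hu u.2) (pad hv v.2)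
  iseqv :=
    { refl := fun u => ⟨u.1, le_rfl, le_rfl, Joined.refl _⟩
      symm := fun ⟨N, hu, hv, h⟩ => ⟨N, hv, hu, h.symm⟩
      trans := by
        rintro u v w ⟨N, hu, hv, h⟩ ⟨M, hv', hw, h'⟩
        refine ⟨max N M, hu.trans (le_max_left _ _), hw.trans (le_max_right _ _), ?_⟩
        have e1 := h.map (continuous_pad (le_max_left N M))
        have e2 := h'.map (continuous_pad (le_max_right N M))
        rw [pad_pad, pad_pad] at e1 e2
        exact e1.trans e2 }

variable (R) in
/-- The group `K₁` of a unital C⋆-algebra: stable homotopy classes of unitary matrices. -/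
def K1Unital : Type _ := Quotient (k1Setoid R)

namespace K1Unital

/-- The class of a unitary matrix. -/
def mk {n : ℕ} (u : UMat R n) : K1Unital R := Quotient.mk (k1Setoid R) ⟨n, u⟩

theorem mk_eq_of_joined {n : ℕ} {u v : UMat R n} (h : Joined u v) : mk u = mk v := by
  apply Quotient.sound
  refine ⟨n, le_rfl, le_rfl, ?_⟩
  simpa only [pad_self] using h

theorem mk_pad {n k : ℕ} (h : n ≤ k) (u : UMat R n) : mk (pad h u) = mk u := by
  apply Quotient.sound
  refine ⟨k, le_rfl, h, ?_⟩
  simp only [pad_self]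
  exact Joined.refl _

theorem mk_corner {n k : ℕ} (S : Matrix (Fin k) (Fin n) R) (hS : Sᴴ * S = 1) (u : UMat R n) :
    mk (corner S hS u) = mk u := by
  set E := inclMat R (Fin.castLE (Nat.le_add_right k n)) with hE
  have hEi : Eᴴ * E = 1 := inclMat_isometry (Fin.castLE_injective _)
  have hES : (E * S)ᴴ * (E * S) = 1 := by
    rw [Matrix.conjTranspose_mul, Matrix.mul_assoc, ← Matrix.mul_assoc Eᴴ, hEi, Matrix.one_mul, hS]
  have h1 : pad (Nat.le_add_right k n) (corner S hS u) = corner (E * S) hES u :=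
    corner_corner _ _ _ _ _ _
  have hi : Function.Injective (Fin.castLE (Nat.le_add_left n k)) := Fin.castLE_injective _
  rw [← mk_pad (Nat.le_add_right k n), ← mk_pad (Nat.le_add_left n k) u,
    ← mk_pad (Nat.le_add_right (k + n) n) (pad _ (corner S hS u)),
    ← mk_pad (Nat.le_add_right (k + n) n) (pad _ u), h1]
  exact mk_eq_of_joined (joined_pad_corner hES (inclMat_isometry hi) u)

/-- The sum of two classes is the class of the product, after both unitaries have been
brought to a common matrix size. -/
instance : Add (K1Unital R) where
  add := Quotient.map₂
    (fun u v => ⟨max u.1 v.1, pad (le_max_left _ _) u.2 * pad (le_max_right _ _) v.2⟩) (by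
      rintro ⟨n, u⟩ ⟨n', u'⟩ ⟨N, hu, hu', h⟩ ⟨m, v⟩ ⟨m', v'⟩ ⟨M, hv, hv', h'⟩
      dsimp only at hu hu' hv hv' h h'
      have e1 := h.map (continuous_pad (le_max_left N M))
      have e2 := h'.map (continuous_pad (le_max_right N M))
      refine ⟨max N M, max_le_max hu hv, max_le_max hu' hv', ?_⟩
      dsimp only
      simp only [map_mul, pad_pad] at e1 e2 ⊢
      exact e1.mul e2)

instance : Zero (K1Unital R) where
  zero := mk (1 : UMat R 0)

instance : Neg (K1Unital R) where
  neg := Quotient.map (fun u => ⟨u.1, u.2⁻¹⟩) (by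
    rintro ⟨n, u⟩ ⟨n', u'⟩ ⟨N, hu, hu', h⟩
    refine ⟨N, hu, hu', ?_⟩
    dsimp only
    simp only [map_inv]
    exact h.inv)

theorem mk_add_mk {n m : ℕ} (u : UMat R n) (v : UMat R m) :
    mk u + mk v = mk (pad (le_max_left n m) u * pad (le_max_right n m) v) := rfl

theorem mk_one (n : ℕ) : mk (1 : UMat R n) = 0 := by
  change _ = mk (1 : UMat R 0)
  rw [← mk_pad (Nat.zero_le n), map_one]

theorem neg_mk {n : ℕ} (u : UMat R n) : -mk u = mk u⁻¹ := rfl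

theorem mk_mul {n : ℕ} (u v : UMat R n) : mk (u * v) = mk u + mk v := by
  rw [mk_add_mk, ← mk_pad (le_max_left n n) (u * v), map_mul]

theorem exists_rep (x : K1Unital R) : ∃ (n : ℕ) (u : UMat R n), x = mk u := by
  obtain ⟨⟨n, u⟩, rfl⟩ := Quotient.exists_rep x
  exact ⟨n, u, rfl⟩

theorem exists_rep₂ (x y : K1Unital R) : ∃ (n : ℕ) (u v : UMat R n), x = mk u ∧ y = mk v := by
  obtain ⟨n, u, rfl⟩ := exists_rep x
  obtain ⟨m, v, rfl⟩ := exists_rep y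
  exact ⟨max n m, pad (le_max_left _ _) u, pad (le_max_right _ _) v, (mk_pad _ _).symm,
    (mk_pad _ _).symm⟩

theorem corner_commute {ι κ μ : Type*} [Fintype ι] [DecidableEq ι] [Fintype κ] [DecidableEq κ]
    [Fintype μ] [DecidableEq μ] {S : Matrix κ ι R} {T : Matrix κ μ R} (hS : Sᴴ * S = 1)
    (hT : Tᴴ * T = 1) (hST : Sᴴ * T = 0) (u : unitary (Matrix ι ι R)) (v : unitary (Matrix μ μ R)) :
    corner S hS u * corner T hT v = corner T hT v * corner S hS u := by
  have hTS : Tᴴ * S = 0 := by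
    have := congrArg Matrix.conjTranspose hST
    simpa using this
  apply Subtype.ext
  change cornerMat S u * cornerMat T v = cornerMat T v * cornerMat S u
  have e1 : S * ((u : Matrix ι ι R) - 1) * Sᴴ * (T * ((v : Matrix μ μ R) - 1) * Tᴴ) = 0 := by
    rw [Matrix.mul_assoc, Matrix.mul_assoc T, ← Matrix.mul_assoc Sᴴ, hST]; simp
  have e2 : (T * ((v : Matrix μ μ R) - 1) * Tᴴ) * (S * ((u : Matrix ι ι R) - 1) * Sᴴ) = 0 := by
    rw [Matrix.mul_assoc, Matrix.mul_assoc S, ← Matrix.mul_assoc Tᴴ, hTS]; simp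
  unfold cornerMat
  simp only [mul_add, add_mul, e1, e2, one_mul, mul_one, add_zero]
  abel

theorem add_comm_aux (x y : K1Unital R) : x + y = y + x := by
  obtain ⟨n, u, v, rfl, rfl⟩ := exists_rep₂ x y
  have hS := inclMat_isometry (R := R) (Fin.castAdd_injective n n)
  have hT := inclMat_isometry (R := R) (Fin.natAdd_injective n n)
  have hST : (inclMat R (Fin.castAdd n : Fin n → Fin (n + n)))ᴴ
      * inclMat R (Fin.natAdd n : Fin n → Fin (n + n)) = 0 := inclMat_orthogonal (by
    intro i j h
    have := congrArg Fin.val h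
    simp at this
    omega)
  rw [← mk_corner _ hS u, ← mk_corner _ hT v, ← mk_mul, ← mk_mul, corner_commute hS hT hST]

instance : AddCommGroup (K1Unital R) where
  add_assoc x y z := by
    obtain ⟨n, u, v, rfl, rfl⟩ := exists_rep₂ x y
    obtain ⟨m, w, rfl⟩ := exists_rep z
    rw [← mk_pad (le_max_left n m) u, ← mk_pad (le_max_left n m) v, ← mk_pad (le_max_right n m) w,
      ← mk_mul, ← mk_mul, ← mk_mul, ← mk_mul, mul_assoc]
  zero_add x := by
    obtain ⟨n, u, rfl⟩ := exists_rep x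
    rw [← mk_one n, ← mk_mul, one_mul]
  add_zero x := by
    obtain ⟨n, u, rfl⟩ := exists_rep x
    rw [← mk_one n, ← mk_mul, mul_one]
  neg_add_cancel x := by
    obtain ⟨n, u, rfl⟩ := exists_rep x
    rw [neg_mk, ← mk_mul, inv_mul_cancel, mk_one]
  add_comm := add_comm_aux
  nsmul := nsmulRec
  zsmul := zsmulRec

end K1Unital

end K1Unital

section MvN

variable {R : Type*} [Ring R] [StarRing R]
variable {ι κ μ ν : Type*} [Fintype ι] [Fintype κ] [Fintype μ] [Fintype ν]

/-- Murray–von Neumann equivalence of matrices of possibly different sizes: `p = v⋆v` and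
`q = vv⋆` for a rectangular matrix `v`. -/
def MvN (p : Matrix ι ι R) (q : Matrix κ κ R) : Prop :=
  ∃ v : Matrix κ ι R, vᴴ * v = p ∧ v * vᴴ = q

theorem MvN.refl {p : Matrix ι ι R} (hp : IsStarProjection p) : MvN p p := by
  have h : pᴴ = p := hp.isSelfAdjoint
  exact ⟨p, by rw [h]; exact hp.isIdempotentElem, by rw [h]; exact hp.isIdempotentElem⟩

theorem MvN.symm {p : Matrix ι ι R} {q : Matrix κ κ R} (h : MvN p q) : MvN q p := by
  obtain ⟨v, h1, h2⟩ := h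
  exact ⟨vᴴ, by simpa using h2, by simpa using h1⟩

theorem MvN.trans {p : Matrix ι ι R} {q : Matrix κ κ R} {r : Matrix μ μ R}
    (hp : IsStarProjection p) (hr : IsStarProjection r) (h : MvN p q) (h' : MvN q r) :
    MvN p r := by
  obtain ⟨v, h1, h2⟩ := h
  obtain ⟨w, h3, h4⟩ := h'
  refine ⟨w * v, ?_, ?_⟩
  · calc (w * v)ᴴ * (w * v) = vᴴ * (wᴴ * w) * v := by
          rw [Matrix.conjTranspose_mul]; simp only [Matrix.mul_assoc]
      _ = (vᴴ * v) * (vᴴ * v) := by rw [h3, ← h2]; simp only [Matrix.mul_assoc]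
      _ = p := by rw [h1]; exact hp.isIdempotentElem
  · calc (w * v) * (w * v)ᴴ = w * (v * vᴴ) * wᴴ := by
          rw [Matrix.conjTranspose_mul]; simp only [Matrix.mul_assoc]
      _ = (w * wᴴ) * (w * wᴴ) := by rw [h2, ← h3]; simp only [Matrix.mul_assoc]
      _ = r := by rw [h4]; exact hr.isIdempotentElem

theorem MvN.reindex {p : Matrix ι ι R} (hp : IsStarProjection p) (e : ι ≃ κ) :
    MvN p (Matrix.reindex e e p) := by
  have h : pᴴ = p := hp.isSelfAdjoint
  have h2 : p * p = p := hp.isIdempotentElem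
  refine ⟨p.submatrix e.symm id, ?_, ?_⟩
  · rw [Matrix.conjTranspose_submatrix, h, Matrix.submatrix_mul_equiv, h2, Matrix.submatrix_id_id]
  · rw [Matrix.conjTranspose_submatrix, h, Matrix.reindex_apply,
      ← Matrix.submatrix_mul _ _ _ _ _ Function.bijective_id, h2]

theorem MvN.fromBlocks {p : Matrix ι ι R} {p' : Matrix κ κ R} {q : Matrix μ μ R}
    {q' : Matrix ν ν R} (h : MvN p p') (h' : MvN q q') :
    MvN (Matrix.fromBlocks p 0 0 q) (Matrix.fromBlocks p' 0 0 q') := by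
  obtain ⟨v, h1, h2⟩ := h
  obtain ⟨w, h3, h4⟩ := h'
  refine ⟨Matrix.fromBlocks v 0 0 w, ?_, ?_⟩ <;>
    simp [Matrix.fromBlocks_conjTranspose, Matrix.fromBlocks_multiply, h1, h2, h3, h4]

theorem isStarProjection_fromBlocks {p : Matrix ι ι R} {q : Matrix κ κ R}
    (hp : IsStarProjection p) (hq : IsStarProjection q) :
    IsStarProjection (Matrix.fromBlocks p 0 0 q) := by
  have h : pᴴ = p := hp.isSelfAdjoint
  have h' : qᴴ = q := hq.isSelfAdjoint
  have h2 : p * p = p := hp.isIdempotentElem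
  have h2' : q * q = q := hq.isIdempotentElem
  constructor
  · simp [IsIdempotentElem, Matrix.fromBlocks_multiply, h2, h2']
  · simp [IsSelfAdjoint, Matrix.star_eq_conjTranspose, Matrix.fromBlocks_conjTranspose, h, h']

theorem isStarProjection_reindex {p : Matrix ι ι R} (hp : IsStarProjection p) (e : ι ≃ κ) :
    IsStarProjection (Matrix.reindex e e p) := by
  have h : pᴴ = p := hp.isSelfAdjoint
  have h2 : p * p = p := hp.isIdempotentElem
  constructor
  · rw [IsIdempotentElem, Matrix.reindex_apply, Matrix.submatrix_mul_equiv, h2]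
  · rw [IsSelfAdjoint, Matrix.star_eq_conjTranspose, Matrix.conjTranspose_reindex, h]

end MvN

section K0Unital

variable (R : Type*) [Ring R] [StarRing R]

/-- A projection in some matrix algebra over `R`. -/
structure MatProj where
  /-- the matrix size -/
  size : ℕ
  /-- the matrix -/
  mat : Matrix (Fin size) (Fin size) R
  /-- it is a projection -/
  isProj : IsStarProjection mat

variable {R}

namespace MatProj

/-- The block sum `p ⊕ q`. -/
def dsum (p q : MatProj R) : MatProj R where
  size := p.size + q.size
  mat := Matrix.reindex finSumFinEquiv finSumFinEquiv (Matrix.fromBlocks p.mat 0 0 q.mat)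
  isProj := isStarProjection_reindex (isStarProjection_fromBlocks p.isProj q.isProj) _

theorem mvN_dsum (p q : MatProj R) :
    MvN (Matrix.fromBlocks p.mat 0 0 q.mat) (p.dsum q).mat :=
  MvN.reindex (isStarProjection_fromBlocks p.isProj q.isProj) _

end MatProj

variable (R) in
/-- Murray–von Neumann equivalence of projections in matrix algebras. -/
def mvnSetoid : Setoid (MatProj R) where
  r p q := MvN p.mat q.mat
  iseqv := ⟨fun p => MvN.refl p.isProj, fun h => h.symm,
    fun {p _ r} h h' => MvN.trans p.isProj r.isProj h h'⟩

variable (R) in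
/-- The monoid of Murray–von Neumann classes of projections in matrix algebras over `R`. -/
def V : Type _ := Quotient (mvnSetoid R)

namespace V

/-- The class of a projection. -/
def mk (p : MatProj R) : V R := Quotient.mk (mvnSetoid R) p

theorem mk_eq_mk {p q : MatProj R} : mk p = mk q ↔ MvN p.mat q.mat := Quotient.eq (r := mvnSetoid R)

/-- Addition is induced by the block sum. -/
instance : Add (V R) where
  add := Quotient.map₂ MatProj.dsum (by
    intro p p' h q q' h'
    exact ((MatProj.mvN_dsum p q).symm.trans (MatProj.dsum p q).isProj
      (isStarProjection_fromBlocks p'.isProj q'.isProj) (h.fromBlocks h')).trans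
      (MatProj.dsum p q).isProj (MatProj.dsum p' q').isProj (MatProj.mvN_dsum p' q'))

instance : Zero (V R) where
  zero := mk ⟨0, 0, IsStarProjection.zero _⟩

theorem mk_add_mk (p q : MatProj R) : mk p + mk q = mk (p.dsum q) := rfl

theorem add_comm_aux (x y : V R) : x + y = y + x := by
  obtain ⟨p, rfl⟩ := Quotient.exists_rep x
  obtain ⟨q, rfl⟩ := Quotient.exists_rep y
  apply mk_eq_mk.2
  have h : MvN (Matrix.fromBlocks p.mat 0 0 q.mat) (Matrix.fromBlocks q.mat 0 0 p.mat) := by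
    have := MvN.reindex (isStarProjection_fromBlocks p.isProj q.isProj) (Equiv.sumComm _ _)
    convert this using 1
    ext i j
    rcases i with i | i <;> rcases j with j | j <;> rfl
  exact ((MatProj.mvN_dsum p q).symm.trans (MatProj.dsum p q).isProj
      (isStarProjection_fromBlocks q.isProj p.isProj) h).trans
      (MatProj.dsum p q).isProj (MatProj.dsum q p).isProj (MatProj.mvN_dsum q p)

theorem zero_add_aux (x : V R) : 0 + x = x := by
  obtain ⟨p, rfl⟩ := Quotient.exists_rep x
  apply mk_eq_mk.2
  refine MvN.symm ?_
  have h0 : IsStarProjection (0 : Matrix (Fin 0) (Fin 0) R) := IsStarProjection.zero _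
  have h : MvN p.mat (Matrix.fromBlocks (0 : Matrix (Fin 0) (Fin 0) R) 0 0 p.mat) := by
    have := MvN.reindex p.isProj (Equiv.emptySum (Fin 0) (Fin p.size)).symm
    convert this using 1
    ext i j
    rcases i with i | i
    · exact i.elim0
    rcases j with j | j
    · exact j.elim0
    rfl
  exact h.trans p.isProj (MatProj.dsum ⟨0, 0, h0⟩ p).isProj (MatProj.mvN_dsum ⟨0, 0, h0⟩ p)

theorem add_assoc_aux (x y z : V R) : x + y + z = x + (y + z) := by
  obtain ⟨p, rfl⟩ := Quotient.exists_rep x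
  obtain ⟨q, rfl⟩ := Quotient.exists_rep y
  obtain ⟨r, rfl⟩ := Quotient.exists_rep z
  apply mk_eq_mk.2
  have hpq := isStarProjection_fromBlocks p.isProj q.isProj
  have hqr := isStarProjection_fromBlocks q.isProj r.isProj
  have hl := isStarProjection_fromBlocks hpq r.isProj
  have hr := isStarProjection_fromBlocks p.isProj hqr
  have e1 : MvN ((p.dsum q).dsum r).mat
      (Matrix.fromBlocks (Matrix.fromBlocks p.mat 0 0 q.mat) 0 0 r.mat) :=
    (MatProj.mvN_dsum _ _).symm.trans (MatProj.isProj _) hl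
      ((MatProj.mvN_dsum p q).symm.fromBlocks (MvN.refl r.isProj))
  have e2 : MvN (Matrix.fromBlocks p.mat 0 0 (Matrix.fromBlocks q.mat 0 0 r.mat))
      (p.dsum (q.dsum r)).mat :=
    ((MvN.refl p.isProj).fromBlocks (MatProj.mvN_dsum q r)).trans hr (MatProj.isProj _)
      (MatProj.mvN_dsum p (q.dsum r))
  have e3 : MvN (Matrix.fromBlocks (Matrix.fromBlocks p.mat 0 0 q.mat) 0 0 r.mat)
      (Matrix.fromBlocks p.mat 0 0 (Matrix.fromBlocks q.mat 0 0 r.mat)) := by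
    have := MvN.reindex hl (Equiv.sumAssoc _ _ _)
    convert this using 1
    ext i j
    rcases i with i | i | i <;> rcases j with j | j | j <;> rfl
  exact (e1.trans (MatProj.isProj _) hr e3).trans (MatProj.isProj _) (MatProj.isProj _) e2

instance : AddCommMonoid (V R) where
  add_assoc := add_assoc_aux
  zero_add := zero_add_aux
  add_zero x := by rw [add_comm_aux, zero_add_aux]
  add_comm := add_comm_aux
  nsmul := nsmulRec

end V

section Map

variable {S : Type*} [Ring S] [StarRing S] [Algebra ℂ R] [Algebra ℂ S]

/-- The image of a projection under a unital ⋆-homomorphism. -/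
def MatProj.map (f : R →⋆ₐ[ℂ] S) (p : MatProj R) : MatProj S where
  size := p.size
  mat := p.mat.map f
  isProj := by
    have h : p.matᴴ = p.mat := p.isProj.isSelfAdjoint
    have h2 : p.mat * p.mat = p.mat := p.isProj.isIdempotentElem
    constructor
    · rw [IsIdempotentElem, ← Matrix.map_mul, h2]
    · rw [IsSelfAdjoint, Matrix.star_eq_conjTranspose,
        ← Matrix.conjTranspose_map _ (fun x => map_star f x), h]

theorem MvN.map {ι κ : Type*} [Fintype ι] [Fintype κ] (f : R →⋆ₐ[ℂ] S)
    {p : Matrix ι ι R} {q : Matrix κ κ R} (h : MvN p q) : MvN (p.map f) (q.map f) := by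
  obtain ⟨v, h1, h2⟩ := h
  refine ⟨v.map f, ?_, ?_⟩
  · rw [← Matrix.conjTranspose_map _ (fun x => map_star f x), ← Matrix.map_mul, h1]
  · rw [← Matrix.conjTranspose_map _ (fun x => map_star f x), ← Matrix.map_mul, h2]

/-- The induced map on Murray–von Neumann classes. -/
def V.map (f : R →⋆ₐ[ℂ] S) : V R →+ V S where
  toFun := Quotient.map (MatProj.map f) (fun _ _ h => MvN.map f h)
  map_zero' := by
    apply V.mk_eq_mk.2
    have : (MatProj.map f ⟨0, 0, IsStarProjection.zero _⟩).mat = 0 := by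
      ext i; exact i.elim0
    rw [this]
    exact MvN.refl (IsStarProjection.zero _)
  map_add' x y := by
    obtain ⟨p, rfl⟩ := Quotient.exists_rep x
    obtain ⟨q, rfl⟩ := Quotient.exists_rep y
    apply V.mk_eq_mk.2
    have : (MatProj.map f (p.dsum q)).mat = ((p.map f).dsum (q.map f)).mat := by
      change ((Matrix.reindex finSumFinEquiv finSumFinEquiv
        (Matrix.fromBlocks p.mat 0 0 q.mat)).map f) = Matrix.reindex finSumFinEquiv finSumFinEquiv
        (Matrix.fromBlocks (p.mat.map f) 0 0 (q.mat.map f))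
      rw [Matrix.reindex_apply, Matrix.reindex_apply, ← Matrix.submatrix_map, Matrix.fromBlocks_map]
      simp
    have h := MvN.refl (MatProj.map f (p.dsum q)).isProj
    exact this ▸ h

theorem V.map_mk (f : R →⋆ₐ[ℂ] S) (p : MatProj R) : V.map f (V.mk p) = V.mk (p.map f) := rfl

end Map

variable (R) in
/-- `K₀` of a unital C⋆-algebra: the Grothendieck group of the monoid of Murray–von Neumann
classes of projections in matrix algebras. -/
abbrev K0Unital : Type _ := Algebra.GrothendieckAddGroup (V R)

/-- The class `[p]` of a projection in `K₀` of a unital C⋆-algebra. -/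
noncomputable def K0Unital.mk (p : MatProj R) : K0Unital R :=
  Algebra.GrothendieckAddGroup.of (V.mk p)

/-- The homomorphism on `K₀` induced by a unital ⋆-homomorphism. -/
noncomputable def K0Unital.map {S : Type*} [Ring S] [StarRing S] [Algebra ℂ R] [Algebra ℂ S]
    (f : R →⋆ₐ[ℂ] S) : K0Unital R →+ K0Unital S :=
  Algebra.GrothendieckAddGroup.lift (Algebra.GrothendieckAddGroup.of.comp (V.map f))

theorem K0Unital.lift_mk {G : Type*} [AddCommGroup G] (f : V R →+ G) (p : MatProj R) :
    Algebra.GrothendieckAddGroup.lift f (K0Unital.mk p) = f (V.mk p) :=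
  DFunLike.congr_fun (Algebra.GrothendieckAddGroup.lift.symm_apply_apply f) (V.mk p)

theorem K0Unital.map_mk {S : Type*} [Ring S] [StarRing S] [Algebra ℂ R] [Algebra ℂ S]
    (f : R →⋆ₐ[ℂ] S) (p : MatProj R) :
    K0Unital.map f (K0Unital.mk p) = K0Unital.mk (p.map f) :=
  K0Unital.lift_mk _ p

end K0Unital

section Exponential

open scoped CStarAlgebra

variable {R : Type*} [CStarAlgebra R] {S : Type*} [CStarAlgebra S]
variable {ι κ : Type*} [Fintype ι] [DecidableEq ι] [Fintype κ] [DecidableEq κ]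

open scoped Matrix.Norms.Operator in
theorem hasSum_exp (x : Matrix ι ι R) :
    HasSum (fun k : ℕ => ((k.factorial : ℂ)⁻¹) • x ^ k) (NormedSpace.exp x) := by
  have : @CompleteSpace (Matrix ι ι R) (PseudoMetricSpace.toUniformSpace) :=
    (inferInstance : CompleteSpace (ι → ι → R))
  exact NormedSpace.exp_series_hasSum_exp' (𝕂 := ℂ) x

open scoped Matrix.Norms.Operator in
theorem continuous_exp : Continuous (NormedSpace.exp : Matrix ι ι R → Matrix ι ι R) := by
  let _ : NormedAlgebra ℚ R := .restrictScalars ℚ ℂ R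
  have : @CompleteSpace (Matrix ι ι R) (PseudoMetricSpace.toUniformSpace) :=
    (inferInstance : CompleteSpace (ι → ι → R))
  exact NormedSpace.exp_continuous

theorem exp_mem_unitary {a : Matrix ι ι R} (ha : IsSelfAdjoint a) (c : ℝ) :
    NormedSpace.exp ((c * Complex.I : ℂ) • a) ∈ unitary (Matrix ι ι R) := by
  let _ : NormedAlgebra ℚ R := .restrictScalars ℚ ℂ R
  set x := (c * Complex.I : ℂ) • a with hx
  have h : star x = -x := by
    rw [hx, star_smul, ha.star_eq, ← neg_smul]
    simp
  have h1 : NormedSpace.exp (-x) * NormedSpace.exp x = 1 := by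
    rw [← Matrix.exp_add_of_commute _ _ (Commute.neg_left (Commute.refl x))]
    simp
  have h2 : NormedSpace.exp x * NormedSpace.exp (-x) = 1 := by
    rw [← Matrix.exp_add_of_commute _ _ (Commute.neg_right (Commute.refl x))]
    simp
  rw [Unitary.mem_iff, NormedSpace.star_exp, h]
  exact ⟨h1, h2⟩

/-- The unitary `exp (i c a)`, for a self-adjoint matrix `a` and a real number `c`. -/
noncomputable def expU (c : ℝ) (a : Matrix ι ι R) (ha : IsSelfAdjoint a) :
    unitary (Matrix ι ι R) :=
  ⟨NormedSpace.exp ((c * Complex.I : ℂ) • a), exp_mem_unitary ha c⟩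

theorem exp_smul_idempotent {e : Matrix ι ι R} (he : e * e = e) (z : ℂ) :
    NormedSpace.exp (z • e) = 1 + (Complex.exp z - 1) • e := by
  refine (hasSum_exp (z • e)).unique ?_
  have h1 : HasSum (fun k : ℕ => ((k.factorial : ℂ)⁻¹ * z ^ k) • e) (Complex.exp z • e) := by
    have := NormedSpace.exp_series_hasSum_exp' (𝕂 := ℂ) z
    rw [← Complex.exp_eq_exp_ℂ] at this
    simpa using this.smul_const e
  have h2 : HasSum (fun k : ℕ => if k = 0 then (1 - e) else 0) (1 - e) := hasSum_ite_eq 0 (1 - e)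
  have h3 := h1.add h2
  have e1 : Complex.exp z • e + (1 - e) = 1 + (Complex.exp z - 1) • e := by
    rw [sub_smul, one_smul]; abel
  rw [e1] at h3
  convert h3 using 2 with k
  rcases k with _ | k
  · simp
  · have hp : ∀ k : ℕ, e ^ (k + 1) = e := by
      intro k
      induction k with
      | zero => simp
      | succ k ih => rw [pow_succ, ih, he]
    simp [smul_pow, hp, smul_smul]

theorem exp_map {f : R →⋆ₐ[ℂ] S} (x : Matrix ι ι R) :
    (NormedSpace.exp x).map f = NormedSpace.exp (x.map f) := by
  have hf : Continuous f := map_continuous f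
  have h := (hasSum_exp x).map (AddMonoidHom.mapMatrix (f : R →+ S)) (by
    change Continuous fun M : Matrix ι ι R => M.map f
    exact continuous_id.matrix_map hf)
  refine h.unique ?_
  convert hasSum_exp (x.map f) using 2 with k
  change ((k.factorial : ℂ)⁻¹ • x ^ k).map f = _
  have hp : (x ^ k).map f = (x.map f) ^ k := by
    exact map_pow (RingHom.mapMatrix (f : R →+* S)) x k
  rw [← hp]
  ext i j
  simp

theorem exp_conj {T : Matrix κ ι R} (hT : Tᴴ * T = 1) (x : Matrix ι ι R) :
    NormedSpace.exp (T * x * Tᴴ) = cornerMat T (NormedSpace.exp x) := by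
  have hp : ∀ k : ℕ, (T * x * Tᴴ) ^ (k + 1) = T * x ^ (k + 1) * Tᴴ := by
    intro k
    induction k with
    | zero => simp
    | succ k ih => rw [pow_succ, ih, conj_mul hT, ← pow_succ]
  let F : Matrix ι ι R →+ Matrix κ κ R :=
    { toFun := fun y => T * y * Tᴴ
      map_zero' := by simp
      map_add' := fun y z => by rw [Matrix.mul_add, Matrix.add_mul] }
  have h1 := (hasSum_exp x).map F (by
    change Continuous fun y : Matrix ι ι R => T * y * Tᴴ
    fun_prop)
  have h2 : HasSum (fun k : ℕ => if k = 0 then (1 - T * Tᴴ) else 0) (1 - T * Tᴴ) :=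
    hasSum_ite_eq 0 _
  have h3 := h1.add h2
  refine (hasSum_exp (T * x * Tᴴ)).unique ?_
  have e1 : F (NormedSpace.exp x) + (1 - T * Tᴴ) = cornerMat T (NormedSpace.exp x) := by
    change T * (NormedSpace.exp x) * Tᴴ + (1 - T * Tᴴ) = _
    rw [cornerMat, Matrix.mul_sub, Matrix.sub_mul, Matrix.mul_one]
    abel
  rw [e1] at h3
  convert h3 using 2 with k
  rcases k with _ | k
  · change _ = T * (((Nat.factorial 0 : ℕ) : ℂ)⁻¹ • x ^ 0 : Matrix ι ι R) * Tᴴ + _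
    simp
  · change _ = T * (((Nat.factorial (k + 1) : ℕ) : ℂ)⁻¹ • x ^ (k + 1) : Matrix ι ι R) * Tᴴ + _
    simp [hp]

theorem cornerMat_unitary (W : unitary (Matrix ι ι R)) (x : Matrix ι ι R) :
    cornerMat (W : Matrix ι ι R) x = W * x * star (W : Matrix ι ι R) := by
  have h : (W : Matrix ι ι R) * (W : Matrix ι ι R)ᴴ = 1 := Unitary.mul_star_self_of_mem W.2
  rw [cornerMat, Matrix.star_eq_conjTranspose, Matrix.mul_sub, Matrix.sub_mul, Matrix.mul_one, h]
  abel

theorem joined_exp_line {a : Matrix ι ι R} (ha : IsSelfAdjoint a) (c : ℝ) :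
    Joined 1 (expU c a ha) := by
  refine ⟨⟨⟨fun t => ⟨NormedSpace.exp (((c * (t : ℝ) : ℝ) * Complex.I : ℂ) • a),
    exp_mem_unitary ha _⟩, ?_⟩, ?_, ?_⟩⟩
  · apply Continuous.subtype_mk
    apply continuous_exp.comp
    fun_prop
  · apply Subtype.ext; simp
  · apply Subtype.ext; simp [expU]

/-- The map on unitary matrices induced by a unital ⋆-homomorphism. -/
def UMat.map (f : R →⋆ₐ[ℂ] S) (n : ℕ) : UMat R n →* UMat S n where
  toFun u := ⟨(u : Matrix (Fin n) (Fin n) R).map f, by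
    have h1 := Unitary.star_mul_self_of_mem u.2
    have h2 := Unitary.mul_star_self_of_mem u.2
    rw [Unitary.mem_iff, Matrix.star_eq_conjTranspose,
      ← Matrix.conjTranspose_map _ (fun x => map_star f x), ← Matrix.map_mul, ← Matrix.map_mul,
      ← Matrix.star_eq_conjTranspose, h1, h2]
    simp⟩
  map_one' := by apply Subtype.ext; simp
  map_mul' u v := by apply Subtype.ext; exact Matrix.map_mul

theorem UMat.map_coe (f : R →⋆ₐ[ℂ] S) {n : ℕ} (u : UMat R n) :
    (UMat.map f n u : Matrix (Fin n) (Fin n) S) = (u : Matrix (Fin n) (Fin n) R).map f := rfl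

theorem UMat.continuous_map (f : R →⋆ₐ[ℂ] S) (n : ℕ) : Continuous (UMat.map f n) := by
  apply Continuous.subtype_mk
  exact continuous_subtype_val.matrix_map (map_continuous f)

theorem UMat.isInducing_map (f : R →⋆ₐ[ℂ] S) (hf : Function.Injective f) (n : ℕ) :
    Topology.IsInducing (UMat.map f n) := by
  have hfi : Topology.IsInducing f := (NonUnitalStarAlgHom.isometry f hf).isEmbedding.isInducing
  have h1 : Topology.IsInducing
      (fun u : UMat R n => (UMat.map f n u : Matrix (Fin n) (Fin n) S)) := by
    have h2 : Topology.IsInducing (fun M : Fin n → Fin n → R => fun i j => f (M i j)) :=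
      Topology.IsInducing.piMap (fun _ => Topology.IsInducing.piMap fun _ => hfi)
    exact h2.comp Topology.IsInducing.subtypeVal
  exact Topology.IsInducing.of_comp (UMat.continuous_map f n) continuous_subtype_val h1

end Exponential

section NonUnital

variable {A B : Type*} [NonUnitalCStarAlgebra A] [NonUnitalCStarAlgebra B]

/-- The canonical character of the unitization (a unit is always adjoined), with kernel `A`. -/
def scalarHom (A : Type*) [NonUnitalCStarAlgebra A] : Unitization ℂ A →⋆ₐ[ℂ] ℂ :=
  { Unitization.fstHom ℂ A with map_star' := fun x => Unitization.fst_star x }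

/-- `K₀` of a C⋆-algebra `A`: the kernel of `K₀(Ã) → K₀(ℂ)`, where `Ã` is the unitization. -/
noncomputable def K0 (A : Type*) [NonUnitalCStarAlgebra A] :
    AddSubgroup (K0Unital (Unitization ℂ A)) :=
  (K0Unital.map (scalarHom A)).ker

theorem scalarHom_apply (x : Unitization ℂ A) : scalarHom A x = x.fst := rfl

theorem scalarHom_comp (φ : A →⋆ₙₐ[ℂ] B) (x : Unitization ℂ A) :
    scalarHom B (Unitization.starMap φ x) = scalarHom A x := by
  induction x with
  | inl_add_inr r a => simp [scalarHom_apply, Unitization.algebraMap_eq_inl]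

theorem K0Unital.map_scalarHom (φ : A →⋆ₙₐ[ℂ] B) (x : K0Unital (Unitization ℂ A)) :
    K0Unital.map (scalarHom B) (K0Unital.map (Unitization.starMap φ) x)
      = K0Unital.map (scalarHom A) x := by
  have h : (K0Unital.map (scalarHom B)).comp (K0Unital.map (Unitization.starMap φ))
      = K0Unital.map (scalarHom A) := by
    apply Algebra.GrothendieckAddGroup.lift.symm.injective
    ext y
    obtain ⟨p, rfl⟩ := Quotient.exists_rep y
    change K0Unital.map (scalarHom B) (K0Unital.map (Unitization.starMap φ) (K0Unital.mk p))
      = K0Unital.map (scalarHom A) (K0Unital.mk p)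
    rw [K0Unital.map_mk, K0Unital.map_mk, K0Unital.map_mk]
    have : (p.map (Unitization.starMap φ)).map (scalarHom B) = p.map (scalarHom A) := by
      unfold MatProj.map
      congr 1
      ext i j
      exact scalarHom_comp φ _
    rw [this]
  exact DFunLike.congr_fun h x

/-- The homomorphism `φ_* : K₀(A) → K₀(B)` induced by a ⋆-homomorphism `φ : A → B`. -/
noncomputable def K0.map (φ : A →⋆ₙₐ[ℂ] B) : K0 A →+ K0 B where
  toFun x := ⟨K0Unital.map (Unitization.starMap φ) x, by
    have h : K0Unital.map (scalarHom A) x = 0 := x.2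
    change K0Unital.map (scalarHom B) _ = 0
    rw [K0Unital.map_scalarHom, h]⟩
  map_zero' := by apply Subtype.ext; simp
  map_add' x y := by apply Subtype.ext; simp

/-- `K₁` of a C⋆-algebra `A`: stable homotopy classes of unitary matrices over the unitization
of `A`. -/
abbrev K1 (A : Type*) [NonUnitalCStarAlgebra A] : Type _ := K1Unital (Unitization ℂ A)

/-- The class in `K₁(A)` of a single unitary of the unitization of `A`. -/
noncomputable def K1.ofUnitary (u : unitary (Unitization ℂ A)) : K1 A :=
  K1Unital.mk (n := 1) ⟨Matrix.of fun _ _ => (u : Unitization ℂ A), by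
    have h1 := Unitary.star_mul_self_of_mem u.2
    have h2 := Unitary.mul_star_self_of_mem u.2
    rw [Unitary.mem_iff]
    constructor <;> ext i j <;> fin_cases i <;> fin_cases j <;> simp [Matrix.mul_apply, h1, h2]⟩

end NonUnital

section Boundary

open scoped CStarAlgebra

/-- The sequence `0 → I → A → B → 0` of ⋆-homomorphisms of C⋆-algebras is exact. -/
structure IsShortExact {I A B : Type*} [NonUnitalCStarAlgebra I] [NonUnitalCStarAlgebra A]
    [NonUnitalCStarAlgebra B] (ι : I →⋆ₙₐ[ℂ] A) (π : A →⋆ₙₐ[ℂ] B) : Prop where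
  injective : Function.Injective ι
  exact : Function.Exact ι π
  surjective : Function.Surjective π

theorem exists_selfAdjoint_lift {R S : Type*} [CStarAlgebra R] [CStarAlgebra S] (f : R →⋆ₐ[ℂ] S)
    (hf : Function.Surjective f) {κ : Type*} (x : Matrix κ κ S) (hx : IsSelfAdjoint x) :
    ∃ a : Matrix κ κ R, IsSelfAdjoint a ∧ a.map f = x := by
  choose g hg using hf
  set b : Matrix κ κ R := x.map g with hb
  have hbx : b.map f = x := by ext i j; simp [hb, hg]
  refine ⟨(1 / 2 : ℂ) • (b + bᴴ), ?_, ?_⟩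
  · rw [IsSelfAdjoint, star_smul, Matrix.star_eq_conjTranspose, Matrix.conjTranspose_add,
      Matrix.conjTranspose_conjTranspose, add_comm]
    congr 1
    simp
  · have h2 : bᴴ.map f = x := by
      rw [Matrix.conjTranspose_map _ (fun x => map_star f x), hbx]
      exact hx
    have : ((1 / 2 : ℂ) • (b + bᴴ)).map f = (1 / 2 : ℂ) • (b.map f + bᴴ.map f) := by
      ext i j; simp
    rw [this, hbx, h2, ← two_smul ℂ x, smul_smul]
    norm_num

theorem reflection_conj {𝔐 : Type*} [Ring 𝔐] [StarRing 𝔐] {w : 𝔐}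
    (hw : w * star w * w = w) (hww : w * w = 0) :
    (1 - (star w * w + w * star w - w - star w)) * (star w * w)
      * (1 - (star w * w + w * star w - w - star w)) = w * star w := by
  have hw' : star w * w * star w = star w := by
    have := congrArg star hw
    simpa [mul_assoc] using this
  have hww' : star w * star w = 0 := by
    have := congrArg star hww
    simpa using this
  have a1 : w * (star w * w) = w := by rw [← mul_assoc]; exact hw
  have a2 : star w * (w * star w) = star w := by rw [← mul_assoc]; exact hw'
  have a3 : ∀ x, w * (w * x) = 0 := fun x => by rw [← mul_assoc, hww, zero_mul]
  have a4 : ∀ x, star w * (star w * x) = 0 := fun x => by rw [← mul_assoc, hww', zero_mul]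
  have b1 : (1 - (star w * w + w * star w - w - star w)) * (star w * w) = w := by
    simp only [add_mul, sub_mul, mul_assoc, one_mul, a1, a4, mul_zero]
    abel
  rw [b1]
  simp only [mul_add, mul_sub, mul_one, a1, a3, hww]
  abel

variable {I A B : Type*} [NonUnitalCStarAlgebra I] [NonUnitalCStarAlgebra A]
  [NonUnitalCStarAlgebra B] {ι : I →⋆ₙₐ[ℂ] A} {π : A →⋆ₙₐ[ℂ] B}

/-- A unitary matrix over `Ã` that becomes the identity over `B̃` comes from a unitary matrix over
`Ĩ`. -/
theorem IsShortExact.exists_unitary (h : IsShortExact ι π) {n : ℕ} (U : UMat (Unitization ℂ A) n)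
    (hU : UMat.map (Unitization.starMap π) n U = 1) :
    ∃ W : UMat (Unitization ℂ I) n, UMat.map (Unitization.starMap ι) n W = U := by
  have h1 : ∀ x : Unitization ℂ A, ∀ r : ℂ, Unitization.starMap π x = Unitization.inl r →
      ∃ y : Unitization ℂ I, Unitization.starMap ι y = x := by
    intro x r
    induction x with
    | inl_add_inr s a =>
      intro hx
      have ha : π a = 0 := by
        have := congrArg (fun x => x.snd) hx
        simpa [Unitization.algebraMap_eq_inl] using this
      obtain ⟨y, hy⟩ := (h.exact a).1 ha
      exact ⟨Unitization.inl s + (y : Unitization ℂ I), by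
        simp [hy, Unitization.algebraMap_eq_inl]⟩
  have h2 : ∀ i j, ∃ y : Unitization ℂ I,
      Unitization.starMap ι y = (U : Matrix (Fin n) (Fin n) (Unitization ℂ A)) i j := by
    intro i j
    refine h1 _ (if i = j then 1 else 0) ?_
    have := congrFun (congrFun (congrArg Subtype.val hU) i) j
    rw [UMat.map_coe, Matrix.map_apply] at this
    rw [this]
    by_cases hij : i = j
    · simp [hij]
    · simp [hij]
  choose W hW using h2
  have hinj := Unitization.starMap_injective (R := ℂ) h.injective
  have hWU : (Matrix.of W).map (Unitization.starMap ι)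
      = (U : Matrix (Fin n) (Fin n) (Unitization ℂ A)) := by
    apply Matrix.ext
    intro i j
    exact hW i j
  have hminj : Function.Injective
      (fun M : Matrix (Fin n) (Fin n) (Unitization ℂ I) => M.map (Unitization.starMap ι)) :=
    Matrix.map_injective hinj
  have hone : (1 : Matrix (Fin n) (Fin n) (Unitization ℂ I)).map (Unitization.starMap ι) = 1 := by
    simp
  refine ⟨⟨Matrix.of W, ?_⟩, Subtype.ext hWU⟩
  rw [Unitary.mem_iff]
  constructor
  · apply hminj
    dsimp only
    rw [Matrix.map_mul, Matrix.star_eq_conjTranspose,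
      Matrix.conjTranspose_map _ (fun x => map_star _ x), hWU, hone]
    exact Unitary.star_mul_self_of_mem U.2
  · apply hminj
    dsimp only
    rw [Matrix.map_mul, Matrix.star_eq_conjTranspose,
      Matrix.conjTranspose_map _ (fun x => map_star _ x), hWU, hone]
    exact Unitary.mul_star_self_of_mem U.2

theorem IsShortExact.joined (h : IsShortExact ι π) {n : ℕ} {W W' : UMat (Unitization ℂ I) n}
    (hJ : JoinedIn {U : UMat (Unitization ℂ A) n | UMat.map (Unitization.starMap π) n U = 1}
      (UMat.map (Unitization.starMap ι) n W) (UMat.map (Unitization.starMap ι) n W')) :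
    Joined W W' := by
  have hind := UMat.isInducing_map (Unitization.starMap ι)
    (Unitization.starMap_injective (R := ℂ) h.injective) n
  rw [← joinedIn_univ]
  refine (hind.joinedIn_image (Set.mem_univ _) (Set.mem_univ _)).1 (hJ.mono ?_)
  intro U hU
  obtain ⟨W, hW⟩ := h.exists_unitary U hU
  exact ⟨W, Set.mem_univ _, hW⟩

/-- `W` is a unitary matrix over `Ĩ` whose image over `Ã` is `exp (2πi a)`, for some self-adjoint
lift `a` of the projection `p` over `B̃`. -/
def IsExpLift (ι : I →⋆ₙₐ[ℂ] A) (π : A →⋆ₙₐ[ℂ] B) {n : ℕ}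
    (p : Matrix (Fin n) (Fin n) (Unitization ℂ B)) (W : UMat (Unitization ℂ I) n) : Prop :=
  ∃ a : Matrix (Fin n) (Fin n) (Unitization ℂ A), IsSelfAdjoint a ∧
    a.map (Unitization.starMap π) = p ∧
    (W : Matrix (Fin n) (Fin n) (Unitization ℂ I)).map (Unitization.starMap ι)
      = NormedSpace.exp ((2 * Real.pi * Complex.I : ℂ) • a)

theorem smul_map {R S : Type*} [CStarAlgebra R] [CStarAlgebra S] (f : R →⋆ₐ[ℂ] S) {κ : Type*}
    (z : ℂ) (a : Matrix κ κ R) : (z • a).map f = z • a.map f := by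
  ext i j; simp

theorem exp_two_pi_map {n : ℕ} {p : Matrix (Fin n) (Fin n) (Unitization ℂ B)}
    (hp : IsStarProjection p) {a : Matrix (Fin n) (Fin n) (Unitization ℂ A)}
    (hap : a.map (Unitization.starMap π) = p) :
    (NormedSpace.exp ((2 * Real.pi * Complex.I : ℂ) • a)).map (Unitization.starMap π) = 1 := by
  rw [exp_map, smul_map, hap, exp_smul_idempotent hp.isIdempotentElem, Complex.exp_two_pi_mul_I]
  simp

theorem two_pi_expU {n : ℕ} {a : Matrix (Fin n) (Fin n) (Unitization ℂ A)} (ha : IsSelfAdjoint a) :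
    (expU (2 * Real.pi) a ha : Matrix (Fin n) (Fin n) (Unitization ℂ A))
      = NormedSpace.exp ((2 * Real.pi * Complex.I : ℂ) • a) := by
  simp [expU]

theorem IsShortExact.exists_expLift (h : IsShortExact ι π) {n : ℕ}
    {p : Matrix (Fin n) (Fin n) (Unitization ℂ B)} (hp : IsStarProjection p) :
    ∃ W, IsExpLift ι π p W := by
  obtain ⟨a, ha, hap⟩ := exists_selfAdjoint_lift (Unitization.starMap π)
    (Unitization.starMap_surjective (R := ℂ) h.surjective) p hp.isSelfAdjoint
  obtain ⟨W, hW⟩ := h.exists_unitary (expU (2 * Real.pi) a ha) (by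
    apply Subtype.ext
    rw [UMat.map_coe, two_pi_expU, exp_two_pi_map hp hap]
    rfl)
  refine ⟨W, a, ha, hap, ?_⟩
  rw [← two_pi_expU ha, ← hW]
  rfl

theorem inclMat_map {R S : Type*} [CStarAlgebra R] [CStarAlgebra S] (f : R →⋆ₐ[ℂ] S) {μ κ : Type*}
    [Fintype μ] [DecidableEq μ] [Fintype κ] [DecidableEq κ] (j : μ → κ) :
    (inclMat R j).map f = inclMat S j := by
  ext i k
  by_cases h : i = j k <;> simp [inclMat_apply, h]

theorem conj_map {R S : Type*} [CStarAlgebra R] [CStarAlgebra S] (f : R →⋆ₐ[ℂ] S) {μ κ : Type*}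
    [Fintype μ] [DecidableEq μ] [Fintype κ] [DecidableEq κ] (T : Matrix κ μ R) (x : Matrix μ μ R) :
    (T * x * Tᴴ).map f = T.map f * x.map f * (T.map f)ᴴ := by
  rw [Matrix.map_mul, Matrix.map_mul, Matrix.conjTranspose_map _ (fun x => map_star f x)]

theorem cornerMat_map {R S : Type*} [CStarAlgebra R] [CStarAlgebra S] (f : R →⋆ₐ[ℂ] S)
    {μ κ : Type*} [Fintype μ] [DecidableEq μ] [Fintype κ] [DecidableEq κ] (T : Matrix κ μ R)
    (x : Matrix μ μ R) :
    (cornerMat T x).map f = cornerMat (T.map f) (x.map f) := by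
  have h1 : (x - 1).map f = x.map f - 1 := by
    rw [Matrix.map_sub _ (fun a b => map_sub f a b)]
    simp
  rw [cornerMat, Matrix.map_add _ (fun a b => map_add f a b), conj_map, h1, cornerMat]
  simp

theorem isSelfAdjoint_conj {R : Type*} [CStarAlgebra R] {μ κ : Type*} [Fintype μ] [Fintype κ]
    (T : Matrix κ μ R) {x : Matrix μ μ R} (hx : IsSelfAdjoint x) :
    IsSelfAdjoint (T * x * Tᴴ) := by
  have h : xᴴ = x := hx
  rw [IsSelfAdjoint, Matrix.star_eq_conjTranspose, Matrix.conjTranspose_mul,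
    Matrix.conjTranspose_mul, Matrix.conjTranspose_conjTranspose, h, Matrix.mul_assoc]

theorem IsExpLift.corner {n k : ℕ} {p : Matrix (Fin n) (Fin n) (Unitization ℂ B)}
    {W : UMat (Unitization ℂ I) n} (hW : IsExpLift ι π p W) {j : Fin n → Fin k}
    (hj : Function.Injective j) :
    IsExpLift ι π (inclMat (Unitization ℂ B) j * p * (inclMat (Unitization ℂ B) j)ᴴ)
      (CStarK.corner (inclMat (Unitization ℂ I) j) (inclMat_isometry hj) W) := by
  obtain ⟨a, ha, hap, hWa⟩ := hW
  refine ⟨inclMat (Unitization ℂ A) j * a * (inclMat (Unitization ℂ A) j)ᴴ, isSelfAdjoint_conj _ ha, ?_, ?_⟩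
  · rw [conj_map, hap, inclMat_map]
  · rw [corner_coe, cornerMat_map, hWa, inclMat_map, ← exp_conj (inclMat_isometry hj)]
    congr 1
    simp

theorem IsExpLift.joined (h : IsShortExact ι π) {n : ℕ}
    {p : Matrix (Fin n) (Fin n) (Unitization ℂ B)} (hp : IsStarProjection p)
    {W W' : UMat (Unitization ℂ I) n} (hW : IsExpLift ι π p W) (hW' : IsExpLift ι π p W') :
    Joined W W' := by
  obtain ⟨a, ha, hap, hWa⟩ := hW
  obtain ⟨b, hb, hbp, hWb⟩ := hW'
  have hc : ∀ t : ℝ, IsSelfAdjoint (((1 - t : ℝ) : ℂ) • a + ((t : ℝ) : ℂ) • b) := by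
    intro t
    refine IsSelfAdjoint.add (IsSelfAdjoint.smul ?_ ha) (IsSelfAdjoint.smul ?_ hb) <;>
      exact Complex.conj_ofReal _
  apply h.joined
  refine ⟨⟨⟨fun t => expU (2 * Real.pi) _ (hc t), ?_⟩, ?_, ?_⟩, ?_⟩
  · apply Continuous.subtype_mk
    apply continuous_exp.comp
    fun_prop
  · apply Subtype.ext
    rw [two_pi_expU, UMat.map_coe, hWa]
    simp
  · apply Subtype.ext
    rw [two_pi_expU, UMat.map_coe, hWb]
    simp
  · intro t
    apply Subtype.ext
    change (expU (2 * Real.pi) _ (hc t) : Matrix (Fin n) (Fin n) (Unitization ℂ A)).map _ = _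
    rw [two_pi_expU]
    refine (exp_two_pi_map hp ?_).trans rfl
    rw [Matrix.map_add _ (fun a b => map_add _ a b), smul_map, smul_map, hap, hbp, ← add_smul]
    simp

theorem exp_pi_map {n : ℕ} {e : Matrix (Fin n) (Fin n) (Unitization ℂ B)}
    (he : IsStarProjection e) {ε : Matrix (Fin n) (Fin n) (Unitization ℂ A)}
    (hεe : ε.map (Unitization.starMap π) = e) (hε : IsSelfAdjoint ε) :
    (expU Real.pi ε hε : Matrix (Fin n) (Fin n) (Unitization ℂ A)).map (Unitization.starMap π)
      = 1 - (2 : ℂ) • e := by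
  unfold expU
  dsimp only
  rw [exp_map, smul_map, hεe, exp_smul_idempotent he.isIdempotentElem, Complex.exp_pi_mul_I,
    sub_eq_add_neg (1 : Matrix (Fin n) (Fin n) (Unitization ℂ B)), ← neg_smul]
  norm_num

theorem joinedIn_conj {G H : Type*} [Group G] [TopologicalSpace G] [IsTopologicalGroup G] [Group H]
    (F : G →* H) {x g : G} (hx : F x = 1) (hg : Joined 1 g) :
    JoinedIn {U | F U = 1} x (g * x * g⁻¹) := by
  obtain ⟨γ⟩ := hg
  refine ⟨⟨⟨fun t => γ t * x * (γ t)⁻¹, by fun_prop⟩, by simp, by simp⟩, ?_⟩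
  intro t
  change F (γ t * x * (γ t)⁻¹) = 1
  rw [map_mul, map_mul, map_inv, hx, mul_one, mul_inv_cancel]

theorem IsExpLift.reflect (h : IsShortExact ι π) {n : ℕ}
    {p e : Matrix (Fin n) (Fin n) (Unitization ℂ B)} (hp : IsStarProjection p)
    (he : IsStarProjection e) {W : UMat (Unitization ℂ I) n} (hW : IsExpLift ι π p W) :
    ∃ W', IsExpLift ι π ((1 - (2 : ℂ) • e) * p * (1 - (2 : ℂ) • e)) W' ∧ Joined W W' := by
  obtain ⟨a, ha, hap, hWa⟩ := hW
  obtain ⟨ε, hε, hεe⟩ := exists_selfAdjoint_lift (Unitization.starMap π)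
    (Unitization.starMap_surjective (R := ℂ) h.surjective) e he.isSelfAdjoint
  set Ω := expU Real.pi ε hε with hΩ
  have hΩe : (Ω : Matrix (Fin n) (Fin n) (Unitization ℂ A)).map (Unitization.starMap π)
      = 1 - (2 : ℂ) • e := exp_pi_map he hεe hε
  have hsa : star (1 - (2 : ℂ) • e) = 1 - (2 : ℂ) • e := by
    rw [star_sub, star_one, star_smul, he.isSelfAdjoint.star_eq]
    simp
  set X := UMat.map (Unitization.starMap ι) n W with hX
  have hX1 : UMat.map (Unitization.starMap π) n X = 1 := by
    apply Subtype.ext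
    rw [UMat.map_coe, hX, UMat.map_coe, hWa, exp_two_pi_map hp hap]
    rfl
  obtain ⟨W', hW'⟩ := h.exists_unitary (Ω * X * Ω⁻¹) (by
    rw [map_mul, map_mul, map_inv, hX1, mul_one, mul_inv_cancel])
  have hXa : (X : Matrix (Fin n) (Fin n) (Unitization ℂ A))
      = NormedSpace.exp ((2 * Real.pi * Complex.I : ℂ) • a) := hWa
  have hΩi : (Ω : Matrix (Fin n) (Fin n) (Unitization ℂ A))ᴴ
      * (Ω : Matrix (Fin n) (Fin n) (Unitization ℂ A)) = 1 :=
    Unitary.star_mul_self_of_mem Ω.2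
  have hlift : IsExpLift ι π ((1 - (2 : ℂ) • e) * p * (1 - (2 : ℂ) • e)) W' := by
    refine ⟨(Ω : Matrix (Fin n) (Fin n) (Unitization ℂ A)) * a
      * (Ω : Matrix (Fin n) (Fin n) (Unitization ℂ A))ᴴ, isSelfAdjoint_conj _ ha, ?_, ?_⟩
    · rw [conj_map, hap, hΩe, ← Matrix.star_eq_conjTranspose, hsa]
    · have e1 := congrArg Subtype.val hW'
      rw [UMat.map_coe] at e1
      rw [e1]
      have e2 : ((Ω * X * Ω⁻¹ : UMat (Unitization ℂ A) n) : Matrix (Fin n) (Fin n) (Unitization ℂ A))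
          = (Ω : Matrix (Fin n) (Fin n) (Unitization ℂ A)) * X
            * star (Ω : Matrix (Fin n) (Fin n) (Unitization ℂ A)) := rfl
      rw [e2, hXa, ← cornerMat_unitary, ← exp_conj hΩi]
      congr 1
      simp
  refine ⟨W', hlift, h.joined ?_⟩
  rw [hW']
  exact joinedIn_conj _ hX1 (joined_exp_line hε Real.pi)

theorem isStarProjection_conj {R : Type*} [CStarAlgebra R] {μ κ : Type*} [Fintype μ]
    [DecidableEq μ] [Fintype κ] [DecidableEq κ]
    {T : Matrix κ μ R} (hT : Tᴴ * T = 1) {x : Matrix μ μ R} (hx : IsStarProjection x) :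
    IsStarProjection (T * x * Tᴴ) := by
  refine ⟨?_, isSelfAdjoint_conj _ hx.isSelfAdjoint⟩
  have h2 : x * x = x := hx.isIdempotentElem
  rw [IsIdempotentElem, conj_mul hT, h2]

theorem inclMat_castAdd_natAdd (R : Type*) [CStarAlgebra R] (n m : ℕ) :
    (inclMat R (Fin.castAdd m : Fin n → Fin (n + m)))ᴴ
      * inclMat R (Fin.natAdd n : Fin m → Fin (n + m)) = 0 :=
  inclMat_orthogonal (by
    intro i j h
    have := congrArg Fin.val h
    simp at this
    omega)

/-- The class of the exponential does not depend on any choice, and only on the Murray–von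
Neumann class of the projection. -/
theorem IsExpLift.mk_eq (h : IsShortExact ι π) {n m : ℕ}
    {p : Matrix (Fin n) (Fin n) (Unitization ℂ B)} {q : Matrix (Fin m) (Fin m) (Unitization ℂ B)}
    (hp : IsStarProjection p) (hq : IsStarProjection q) (hpq : MvN p q)
    {W : UMat (Unitization ℂ I) n} {W' : UMat (Unitization ℂ I) m} (hW : IsExpLift ι π p W)
    (hW' : IsExpLift ι π q W') : K1Unital.mk W = K1Unital.mk W' := by
  obtain ⟨v, hv1, hv2⟩ := hpq
  have hpp : p * p = p := hp.isIdempotentElem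
  have hqq : q * q = q := hq.isIdempotentElem
  have hps : pᴴ = p := hp.isSelfAdjoint
  have hqs : qᴴ = q := hq.isSelfAdjoint
  set S := inclMat (Unitization ℂ B) (Fin.castAdd m : Fin n → Fin (n + m)) with hSdef
  set T := inclMat (Unitization ℂ B) (Fin.natAdd n : Fin m → Fin (n + m)) with hTdef
  have hS : Sᴴ * S = 1 := inclMat_isometry (Fin.castAdd_injective n m)
  have hT : Tᴴ * T = 1 := inclMat_isometry (Fin.natAdd_injective m n)
  have hST : Sᴴ * T = 0 := inclMat_castAdd_natAdd _ n m
  -- replace `v` by a partial isometry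
  set w' := q * v * p with hw'
  have hw1 : w'ᴴ * w' = p := by
    calc w'ᴴ * w' = p * (vᴴ * (q * q) * v) * p := by
          rw [hw', Matrix.conjTranspose_mul, Matrix.conjTranspose_mul, hps, hqs]
          simp only [Matrix.mul_assoc]
      _ = p * ((vᴴ * v) * (vᴴ * v)) * p := by rw [hqq, ← hv2]; simp only [Matrix.mul_assoc]
      _ = p := by rw [hv1, hpp, hpp, hpp]
  have hw2 : w' * w'ᴴ = q := by
    calc w' * w'ᴴ = q * (v * (p * p) * vᴴ) * q := by
          rw [hw', Matrix.conjTranspose_mul, Matrix.conjTranspose_mul, hps, hqs]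
          simp only [Matrix.mul_assoc]
      _ = q * ((v * vᴴ) * (v * vᴴ)) * q := by rw [hpp, ← hv1]; simp only [Matrix.mul_assoc]
      _ = q := by rw [hv2, hqq, hqq, hqq]
  have hw3 : w' * p = w' := by rw [hw', Matrix.mul_assoc, hpp]
  set w := T * w' * Sᴴ with hwdef
  have hws : star w = S * w'ᴴ * Tᴴ := by
    rw [hwdef, Matrix.star_eq_conjTranspose, Matrix.conjTranspose_mul, Matrix.conjTranspose_mul,
      Matrix.conjTranspose_conjTranspose, Matrix.mul_assoc]
  have hsw : star w * w = S * p * Sᴴ := by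
    calc star w * w = S * w'ᴴ * (Tᴴ * T) * w' * Sᴴ := by
          rw [hws, hwdef]; simp only [Matrix.mul_assoc]
      _ = S * (w'ᴴ * w') * Sᴴ := by rw [hT, Matrix.mul_one]; simp only [Matrix.mul_assoc]
      _ = _ := by rw [hw1]
  have hwsw : w * star w = T * q * Tᴴ := by
    calc w * star w = T * w' * (Sᴴ * S) * w'ᴴ * Tᴴ := by
          rw [hws, hwdef]; simp only [Matrix.mul_assoc]
      _ = T * (w' * w'ᴴ) * Tᴴ := by rw [hS, Matrix.mul_one]; simp only [Matrix.mul_assoc]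
      _ = _ := by rw [hw2]
  have hww : w * w = 0 := by
    calc w * w = T * w' * (Sᴴ * T) * w' * Sᴴ := by
          rw [hwdef]; simp only [Matrix.mul_assoc]
      _ = 0 := by rw [hST]; simp
  have hwww : w * star w * w = w := by
    rw [mul_assoc, hsw, hwdef]
    calc T * w' * Sᴴ * (S * p * Sᴴ) = T * w' * (Sᴴ * S) * p * Sᴴ := by
          simp only [Matrix.mul_assoc]
      _ = T * (w' * p) * Sᴴ := by rw [hS, Matrix.mul_one]; simp only [Matrix.mul_assoc]
      _ = _ := by rw [hw3]
  have he := isStarProjection_half hwww hww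
  have h2e : (2 : ℂ) • ((1 / 2 : ℂ) • (star w * w + w * star w - w - star w))
      = star w * w + w * star w - w - star w := by
    rw [smul_smul]; norm_num
  obtain ⟨W2, hW2, hJ⟩ := IsExpLift.reflect h (isStarProjection_conj hS hp) he
    (hW.corner (Fin.castAdd_injective n m))
  rw [h2e, ← hsw, reflection_conj hwww hww, hwsw] at hW2
  have hJ2 := IsExpLift.joined h (isStarProjection_conj hT hq) hW2
    (hW'.corner (Fin.natAdd_injective m n))
  have := K1Unital.mk_eq_of_joined (hJ.trans hJ2)
  rwa [K1Unital.mk_corner, K1Unital.mk_corner] at this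

theorem blockSum_eq {R : Type*} [CStarAlgebra R] {n m : ℕ} (p : Matrix (Fin n) (Fin n) R)
    (q : Matrix (Fin m) (Fin m) R) :
    Matrix.reindex finSumFinEquiv finSumFinEquiv (Matrix.fromBlocks p 0 0 q)
      = inclMat R (Fin.castAdd m : Fin n → Fin (n + m)) * p
        * (inclMat R (Fin.castAdd m : Fin n → Fin (n + m)))ᴴ
      + inclMat R (Fin.natAdd n : Fin m → Fin (n + m)) * q
        * (inclMat R (Fin.natAdd n : Fin m → Fin (n + m)))ᴴ := by
  have e1 : ∀ (i : Fin n) (j : Fin m), Fin.castAdd m i ≠ Fin.natAdd n j := by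
    intro i j h
    have := congrArg Fin.val h
    simp at this
    omega
  ext i j
  induction i using Fin.addCases <;> induction j using Fin.addCases <;>
    simp [Matrix.mul_apply, inclMat_apply, e1, fun i j => (e1 i j).symm, apply_ite star]

theorem IsExpLift.blockSum {n m : ℕ} {p : Matrix (Fin n) (Fin n) (Unitization ℂ B)}
    {q : Matrix (Fin m) (Fin m) (Unitization ℂ B)}
    {W : UMat (Unitization ℂ I) n} {W' : UMat (Unitization ℂ I) m}
    (hW : IsExpLift ι π p W) (hW' : IsExpLift ι π q W') :
    IsExpLift ι π (Matrix.reindex finSumFinEquiv finSumFinEquiv (Matrix.fromBlocks p 0 0 q))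
      (CStarK.corner (inclMat (Unitization ℂ I) (Fin.castAdd m))
          (inclMat_isometry (Fin.castAdd_injective n m)) W
        * CStarK.corner (inclMat (Unitization ℂ I) (Fin.natAdd n))
          (inclMat_isometry (Fin.natAdd_injective m n)) W') := by
  obtain ⟨a, ha, hap, hWa⟩ := hW
  obtain ⟨b, hb, hbp, hWb⟩ := hW'
  set S := inclMat (Unitization ℂ A) (Fin.castAdd m : Fin n → Fin (n + m))
    with hSdef
  set T := inclMat (Unitization ℂ A) (Fin.natAdd n : Fin m → Fin (n + m))
    with hTdef
  have hS : Sᴴ * S = 1 := inclMat_isometry (Fin.castAdd_injective _ _)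
  have hT : Tᴴ * T = 1 := inclMat_isometry (Fin.natAdd_injective _ _)
  have hST : Sᴴ * T = 0 := inclMat_castAdd_natAdd _ _ _
  have hTS : Tᴴ * S = 0 := by
    have := congrArg Matrix.conjTranspose hST
    simpa using this
  have e1 : (S * a * Sᴴ) * (T * b * Tᴴ) = 0 := by
    rw [Matrix.mul_assoc, Matrix.mul_assoc T, ← Matrix.mul_assoc Sᴴ, hST]; simp
  have e2 : (T * b * Tᴴ) * (S * a * Sᴴ) = 0 := by
    rw [Matrix.mul_assoc, Matrix.mul_assoc S, ← Matrix.mul_assoc Tᴴ, hTS]; simp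
  refine ⟨S * a * Sᴴ + T * b * Tᴴ, (isSelfAdjoint_conj _ ha).add (isSelfAdjoint_conj _ hb), ?_, ?_⟩
  · rw [Matrix.map_add _ (fun a b => map_add _ a b), conj_map, conj_map, hap, hbp, hSdef, hTdef,
      inclMat_map, inclMat_map, blockSum_eq]
  · have hc : Commute ((2 * Real.pi * Complex.I : ℂ) • (S * a * Sᴴ))
        ((2 * Real.pi * Complex.I : ℂ) • (T * b * Tᴴ)) := by
      rw [Commute, SemiconjBy, smul_mul_smul_comm, smul_mul_smul_comm, e1, e2]
    let _ : NormedAlgebra ℚ (Unitization ℂ A) := .restrictScalars ℚ ℂ _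
    have e3 : (2 * Real.pi * Complex.I : ℂ) • (S * a * Sᴴ)
        = S * ((2 * Real.pi * Complex.I : ℂ) • a) * Sᴴ := by simp
    have e4 : (2 * Real.pi * Complex.I : ℂ) • (T * b * Tᴴ)
        = T * ((2 * Real.pi * Complex.I : ℂ) • b) * Tᴴ := by simp
    rw [smul_add, Matrix.exp_add_of_commute _ _ hc, e3, e4, exp_conj hS, exp_conj hT, ← hWa, ← hWb,
      hSdef, hTdef, ← inclMat_map (Unitization.starMap ι), ← inclMat_map (Unitization.starMap ι),
      ← cornerMat_map, ← cornerMat_map, ← Matrix.map_mul]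
    rfl

/-- The homomorphism `V(B̃) → K₁(I)` sending the class of a projection `p` to the class of
`exp (2πi a)`, for a self-adjoint lift `a` of `p`. -/
noncomputable def expV (h : IsShortExact ι π) : V (Unitization ℂ B) →+ K1 I where
  toFun := Quotient.lift (fun p => K1Unital.mk (h.exists_expLift p.isProj).choose) (by
    intro p q hpq
    exact IsExpLift.mk_eq h p.isProj q.isProj hpq (h.exists_expLift p.isProj).choose_spec
      (h.exists_expLift q.isProj).choose_spec)
  map_zero' := by
    have h0 : IsStarProjection (0 : Matrix (Fin 0) (Fin 0) (Unitization ℂ B)) :=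
      IsStarProjection.zero _
    change K1Unital.mk (h.exists_expLift h0).choose = _
    rw [← K1Unital.mk_one 0]
    congr 1
    apply Subtype.ext
    apply Matrix.ext
    intro i
    exact i.elim0
  map_add' x y := by
    obtain ⟨p, rfl⟩ := Quotient.exists_rep x
    obtain ⟨q, rfl⟩ := Quotient.exists_rep y
    have h1 := (h.exists_expLift p.isProj).choose_spec
    have h2 := (h.exists_expLift q.isProj).choose_spec
    have h3 := (h.exists_expLift (p.dsum q).isProj).choose_spec
    have h4 := IsExpLift.mk_eq h (p.dsum q).isProj (p.dsum q).isProj (MvN.refl (p.dsum q).isProj)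
      h3 (h1.blockSum h2)
    exact h4.trans ((K1Unital.mk_mul _ _).trans
      (congrArg₂ (· + ·) (K1Unital.mk_corner _ _ _) (K1Unital.mk_corner _ _ _)))

theorem expV_mk (h : IsShortExact ι π) (p : MatProj (Unitization ℂ B))
    {W : UMat (Unitization ℂ I) p.size} (hW : IsExpLift ι π p.mat W) :
    expV h (V.mk p) = K1Unital.mk W :=
  IsExpLift.mk_eq h p.isProj p.isProj (MvN.refl p.isProj) (h.exists_expLift p.isProj).choose_spec hW

/-- The exponential (boundary) map `∂ : K₀(B) → K₁(I)` of the short exact sequence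
`0 → I → A → B → 0`: it sends `[p] - [q]` to `[exp (2πi a)] - [exp (2πi b)]`, where `a`, `b` are
self-adjoint lifts of the projections `p`, `q`. -/
noncomputable def expMap (h : IsShortExact ι π) : K0 B →+ K1 I :=
  (Algebra.GrothendieckAddGroup.lift (expV h)).comp (K0 B).subtype

/-- The defining property of the exponential map, for all choices of lifts. -/
theorem expMap_apply (h : IsShortExact ι π) (x : K0 B) (p q : MatProj (Unitization ℂ B))
    (hx : (x : K0Unital (Unitization ℂ B)) = K0Unital.mk p - K0Unital.mk q)
    {W : UMat (Unitization ℂ I) p.size} (hW : IsExpLift ι π p.mat W)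
    {W' : UMat (Unitization ℂ I) q.size} (hW' : IsExpLift ι π q.mat W') :
    expMap h x = K1Unital.mk W - K1Unital.mk W' := by
  change Algebra.GrothendieckAddGroup.lift (expV h) (x : K0Unital (Unitization ℂ B)) = _
  rw [hx, map_sub, K0Unital.lift_mk, K0Unital.lift_mk, expV_mk h p hW, expV_mk h q hW']

end Boundary

section QC

open scoped ComplexOrder ZeroAtInfty

/-- The half-open interval `(0, 1]`. -/
abbrev Ioc01 : Type := Set.Ioc (0 : ℝ) 1

/-- The point `1` of `(0, 1]`. -/
def Ioc01.one : Ioc01 := ⟨1, by norm_num⟩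

/-- The C⋆-algebra `C₀((0, 1], M₂)`. -/
def ConeM2 : Type := C₀(Ioc01, CStarMatrix (Fin 2) (Fin 2) ℂ)

noncomputable instance : NonUnitalCStarAlgebra ConeM2 :=
  inferInstanceAs (NonUnitalCStarAlgebra C₀(Ioc01, CStarMatrix (Fin 2) (Fin 2) ℂ))

/-- The value at `t` of an element of `C₀((0, 1], M₂)`. -/
noncomputable def ConeM2.eval (f : ConeM2) (t : Ioc01) : CStarMatrix (Fin 2) (Fin 2) ℂ :=
  ZeroAtInftyContinuousMap.toContinuousMap f t

/-- The C⋆-algebra `qℂ = {f ∈ C₀((0, 1], M₂) | f(1) is diagonal}`. -/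
noncomputable def qCSub : NonUnitalStarSubalgebra ℂ ConeM2 where
  carrier := {f | ∀ i j, i ≠ j → f.eval Ioc01.one i j = 0}
  add_mem' {f g} hf hg i j hij := by
    change f.eval _ i j + g.eval _ i j = 0
    rw [hf i j hij, hg i j hij, add_zero]
  zero_mem' i j hij := rfl
  mul_mem' {f g} hf hg i j hij := by
    change (f.eval Ioc01.one * g.eval Ioc01.one) i j = 0
    rw [CStarMatrix.mul_apply]
    apply Finset.sum_eq_zero
    intro k _
    by_cases hik : i = k
    · subst hik; rw [hg i j hij, mul_zero]
    · rw [hf i k hik, zero_mul]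
  smul_mem' c f hf i j hij := by
    change c • (f.eval _ i j) = 0
    rw [hf i j hij, smul_zero]
  star_mem' {f} hf i j hij := by
    change star (f.eval _ j i) = 0
    rw [hf j i hij.symm, star_zero]

instance isClosed_qCSub : IsClosed (qCSub : Set ConeM2) := by
  have hc : Continuous (fun f : C₀(Ioc01, CStarMatrix (Fin 2) (Fin 2) ℂ) => f Ioc01.one) :=
    (continuous_eval_const _ : Continuous (fun f : BoundedContinuousFunction Ioc01
      (CStarMatrix (Fin 2) (Fin 2) ℂ) => f Ioc01.one)).comp
      (ZeroAtInftyContinuousMap.isometry_toBCF).continuous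
  have : (qCSub : Set ConeM2) = ⋂ (i : Fin 2) (j : Fin 2) (_ : i ≠ j),
      {f : ConeM2 | f.eval Ioc01.one i j = 0} := by
    ext f
    simp only [Set.mem_iInter]
    rfl
  rw [this]
  refine isClosed_iInter fun i => isClosed_iInter fun j => isClosed_iInter fun _ => ?_
  refine isClosed_eq ?_ continuous_const
  have h2 : Continuous (fun M : CStarMatrix (Fin 2) (Fin 2) ℂ => M i j) := by
    fun_prop
  exact h2.comp hc

/-- The C⋆-algebra `qℂ`. -/
abbrev qC : Type := qCSub

noncomputable instance : NonUnitalCStarAlgebra qC := inferInstance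

theorem qC.ext {f g : qC} (h : ∀ t, f.1.eval t = g.1.eval t) : f = g := by
  apply Subtype.ext
  exact ZeroAtInftyContinuousMap.ext h

theorem qC.eval_mul (f g : qC) (t : Ioc01) : (f * g).1.eval t = f.1.eval t * g.1.eval t := rfl

theorem qC.eval_add (f g : qC) (t : Ioc01) : (f + g).1.eval t = f.1.eval t + g.1.eval t := rfl

theorem qC.eval_star (f : qC) (t : Ioc01) : (star f).1.eval t = star (f.1.eval t) := rfl

theorem tendsto_Ioc01 :
    Filter.Tendsto (fun t : Ioc01 => (t : ℝ)) (Filter.cocompact Ioc01) (nhds 0) := by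
  rw [Metric.tendsto_nhds]
  intro ε hε
  have hcpt : IsCompact ((fun t : Ioc01 => (t : ℝ)) ⁻¹' Set.Icc ε 1) := by
    refine (Topology.IsInducing.subtypeVal.isCompact_preimage_iff ?_).2 isCompact_Icc
    intro t ht
    exact ⟨⟨t, lt_of_lt_of_le hε ht.1, ht.2⟩, rfl⟩
  filter_upwards [hcpt.compl_mem_cocompact] with t ht
  rw [Real.dist_eq, sub_zero, abs_of_pos t.2.1]
  by_contra hcon
  exact ht ⟨not_lt.1 hcon, t.2.2⟩

/-- The function `t ↦ g(t) M` in `C₀((0, 1], M₂)`, where `g` is continuous and `g(0) = 0`. -/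
noncomputable def coneElt (g : ℝ → ℂ) (hg : Continuous g) (hg0 : g 0 = 0)
    (M : CStarMatrix (Fin 2) (Fin 2) ℂ) : ConeM2 :=
  show C₀(Ioc01, CStarMatrix (Fin 2) (Fin 2) ℂ) from
  { toFun := fun t => g t • M
    continuous_toFun := (hg.comp continuous_subtype_val).smul continuous_const
    zero_at_infty' := by
      have h := (hg.tendsto 0).comp tendsto_Ioc01
      rw [hg0] at h
      simpa using h.smul_const M }

theorem coneElt_eval (g : ℝ → ℂ) (hg : Continuous g) (hg0 : g 0 = 0)
    (M : CStarMatrix (Fin 2) (Fin 2) ℂ) (t : Ioc01) :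
    (coneElt g hg hg0 M).eval t = g t • M := rfl

/-- The element `h₀ = t ⊗ e₁₁` of `qℂ`. -/
noncomputable def h0 : qC :=
  ⟨coneElt (fun t => t) (by fun_prop) (by simp) (CStarMatrix.ofMatrix !![1, 0; 0, 0]), by
    intro i j hij
    rw [coneElt_eval]
    fin_cases i <;> fin_cases j <;> simp at hij ⊢⟩

/-- The element `k₀ = t ⊗ e₂₂` of `qℂ`. -/
noncomputable def k0 : qC :=
  ⟨coneElt (fun t => t) (by fun_prop) (by simp) (CStarMatrix.ofMatrix !![0, 0; 0, 1]), by
    intro i j hij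
    rw [coneElt_eval]
    fin_cases i <;> fin_cases j <;> simp at hij ⊢⟩

/-- The element `x₀ = √(t - t²) ⊗ e₂₁` of `qℂ`. -/
noncomputable def x0 : qC :=
  ⟨coneElt (fun t => (Real.sqrt (t - t ^ 2) : ℂ)) (by fun_prop) (by simp)
      (CStarMatrix.ofMatrix !![0, 0; 1, 0]), by
    intro i j hij
    rw [coneElt_eval]
    simp [Ioc01.one]⟩

theorem sqrt_mul_sqrt (t : Ioc01) :
    (Real.sqrt ((t : ℝ) - (t : ℝ) ^ 2) : ℂ) * (Real.sqrt ((t : ℝ) - (t : ℝ) ^ 2) : ℂ)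
      = (t : ℝ) - (t : ℝ) * (t : ℝ) := by
  have h : 0 ≤ (t : ℝ) - (t : ℝ) ^ 2 := by nlinarith [t.2.1, t.2.2]
  rw [← Complex.ofReal_mul, Real.mul_self_sqrt h]
  push_cast
  ring

theorem cstar_apply (M : CStarMatrix (Fin 2) (Fin 2) ℂ) (i j : Fin 2) :
    (star M) i j = star (M j i) := rfl

theorem star_h0 : star h0 = h0 := by
  apply qC.ext
  intro t
  rw [qC.eval_star]
  simp only [h0, coneElt_eval]
  ext i j
  fin_cases i <;> fin_cases j <;> simp [cstar_apply]

theorem star_k0 : star k0 = k0 := by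
  apply qC.ext
  intro t
  rw [qC.eval_star]
  simp only [k0, coneElt_eval]
  ext i j
  fin_cases i <;> fin_cases j <;> simp [cstar_apply]

theorem h0_rel : h0 * h0 + star x0 * x0 = h0 := by
  apply qC.ext
  intro t
  rw [qC.eval_add, qC.eval_mul, qC.eval_mul, qC.eval_star]
  simp only [h0, x0, coneElt_eval]
  ext i j
  fin_cases i <;> fin_cases j <;> simp [CStarMatrix.mul_apply, cstar_apply, sqrt_mul_sqrt]

theorem k0_rel : k0 * k0 + x0 * star x0 = k0 := by
  apply qC.ext
  intro t
  rw [qC.eval_add, qC.eval_mul, qC.eval_mul, qC.eval_star]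
  simp only [k0, x0, coneElt_eval]
  ext i j
  fin_cases i <;> fin_cases j <;> simp [CStarMatrix.mul_apply, cstar_apply, sqrt_mul_sqrt]

theorem x0_rel : k0 * x0 = x0 * h0 := by
  apply qC.ext
  intro t
  rw [qC.eval_mul, qC.eval_mul]
  simp only [h0, k0, x0, coneElt_eval]
  ext i j
  fin_cases i <;> fin_cases j <;> simp [CStarMatrix.mul_apply, mul_comm]

/-- The matrix `T(h, x, k) = [[1 - h, x⋆], [x, k]]` over the unitization of `A`. -/
def Tmat {A : Type*} [NonUnitalCStarAlgebra A] (h x k : A) :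
    Matrix (Fin 2) (Fin 2) (Unitization ℂ A) :=
  !![1 - (h : Unitization ℂ A), ((star x : A) : Unitization ℂ A);
    (x : Unitization ℂ A), (k : Unitization ℂ A)]

theorem isStarProjection_Tmat {A : Type*} [NonUnitalCStarAlgebra A] {h x k : A}
    (hh : star h = h) (hk : star k = k) (h1 : h * h + star x * x = h)
    (h2 : k * k + x * star x = k) (h3 : k * x = x * h) : IsStarProjection (Tmat h x k) := by
  have h4 : star x * k = h * star x := by
    have := congrArg star h3
    simpa [hh, hk] using this
  have h1' := congrArg (fun a : A => (a : Unitization ℂ A)) h1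
  have h2' := congrArg (fun a : A => (a : Unitization ℂ A)) h2
  have h3' := congrArg (fun a : A => (a : Unitization ℂ A)) h3
  have h4' := congrArg (fun a : A => (a : Unitization ℂ A)) h4
  simp only [Unitization.inr_mul, Unitization.inr_add] at h1' h2' h3' h4'
  constructor
  · have e1 : (1 - (h : Unitization ℂ A)) * (1 - (h : Unitization ℂ A))
        + ((star x : A) : Unitization ℂ A) * x = 1 - h := by
      calc _ = 1 - (h : Unitization ℂ A) - h
            + ((h : Unitization ℂ A) * h + ((star x : A) : Unitization ℂ A) * x) := by noncomm_ring
        _ = 1 - h := by rw [h1']; abel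
    have e2 : (1 - (h : Unitization ℂ A)) * ((star x : A) : Unitization ℂ A)
        + ((star x : A) : Unitization ℂ A) * k = (star x : A) := by
      rw [h4', sub_mul, one_mul, sub_add_cancel]
    have e3 : (x : Unitization ℂ A) * (1 - (h : Unitization ℂ A)) + (k : Unitization ℂ A) * x
        = x := by
      rw [h3', mul_sub, mul_one, sub_add_cancel]
    have e4 : (x : Unitization ℂ A) * ((star x : A) : Unitization ℂ A)
        + (k : Unitization ℂ A) * k = k := by
      rw [add_comm]; exact h2'
    rw [IsIdempotentElem, Tmat, Matrix.mul_fin_two, e1, e2, e3, e4]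
  · rw [IsSelfAdjoint, Tmat, Matrix.star_eq_conjTranspose]
    apply Matrix.ext
    intro i j
    fin_cases i <;> fin_cases j <;> simp [← Unitization.inr_star, hh, hk]

/-- The projection `P₀ = T(h₀, x₀, k₀)` over the unitization of `qℂ`. -/
noncomputable def P0 : MatProj (Unitization ℂ qC) where
  size := 2
  mat := Tmat h0 x0 k0
  isProj := isStarProjection_Tmat star_h0 star_k0 h0_rel k0_rel x0_rel

/-- The unit of `R`, as a projection of size one. -/
def unitProj (R : Type*) [Ring R] [StarRing R] : MatProj R := ⟨1, 1, IsStarProjection.one _⟩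

theorem mvN_e11 : MvN (!![1, 0; 0, 0] : Matrix (Fin 2) (Fin 2) ℂ)
    (1 : Matrix (Fin 1) (Fin 1) ℂ) := by
  refine ⟨(!![1, 0] : Matrix (Fin 1) (Fin 2) ℂ), ?_, ?_⟩
  · ext i j
    fin_cases i <;> fin_cases j <;> simp [Matrix.mul_apply]
  · ext i j
    fin_cases i; fin_cases j; simp [Matrix.mul_apply]

/-- The element `[P₀] - [1]` of `K₀(qℂ)`. -/
noncomputable def b : K0 qC :=
  ⟨K0Unital.mk P0 - K0Unital.mk (unitProj (Unitization ℂ qC)), by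
    change K0Unital.map (scalarHom qC) _ = 0
    rw [map_sub, K0Unital.map_mk, K0Unital.map_mk, sub_eq_zero]
    have h1 : (P0.map (scalarHom qC)).mat = !![1, 0; 0, 0] := by
      change (Tmat h0 x0 k0).map (scalarHom qC) = _
      ext i j
      fin_cases i <;> fin_cases j <;> simp [Tmat, scalarHom_apply, sub_eq_add_neg]
    have h2 : ((unitProj (Unitization ℂ qC)).map (scalarHom qC)).mat = 1 := by
      change (1 : Matrix (Fin 1) (Fin 1) (Unitization ℂ qC)).map (scalarHom qC) = 1
      simp
    refine congrArg Algebra.GrothendieckAddGroup.of (V.mk_eq_mk.2 ?_)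
    rw [h1, h2]
    exact mvN_e11⟩

end QC

end CStarK

/-! The boundary of a `K₀`-class records how a loop fails to lift. Let `P` be a projection in
`M₂(B̃)` with self-adjoint lift `T`, and let `E = diag(1, 0)`. Then `s ↦ exp(2πisP) exp(-2πisE)` is
a loop of unitaries over `B̃` based at `1`. Its lift `s ↦ exp(2πisT) exp(-2πisE)` starts at `1` and
ends at `exp(2πiT)`, the unitary that represents the boundary. Any two lifts of one loop that start
at `1` have endpoints joined by unitaries over `Ĩ` (`joinedIn_ker_of_path_lifts`), and a homotopy of
loops lifts too (`exists_UMat_path_lift`). So the class of the endpoint depends only on the homotopy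
class of the loop, and it suffices to deform the loop of `P = T(h, x, k)` into one of the form `v ⊕
1` with `v` of size one.

The special shape of `qℂ` makes this possible. Besides the relations that make `T(h, x, k)` a
projection, its generators satisfy `hk = 0` and `x² = 0`. At the point `t`, after removing a common
summand from `P₀` and `E`, what is left of `P₀` is the rank-one projection `W` onto `√(1-t) e + √t
f`, where `e` spans the range of `h₀` in the first copy of `ℂ²`, `f` spans the range of `k₀` in the
second copy, and the rest of `E` is the projection onto `e`. The vector of the first copy that spans
the range of `k₀` is orthogonal to `e`, so `f` can be rotated into it through a quarter turn, after
which everything lies in the upper left entry.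

The projections met on the way need not have entries in `B̃`, but `D = W - E` and `C = (W - E)E` do.
For `|z| = 1`, `(1 + (z - 1)W)(1 + (z̄ - 1)E) = 1 + (z - 1)D + (2 - z - z̄)C`, and the right side is
`projLoop`. It is unitary by the algebraic identities `QCRel.relations`, so no representation of `B`
is needed. At one end of the rotation it is the loop of `P` (`projLoop_one_zero`), at the other it
is `v ⊕ 1` (`cornerMat_cornerLoop`). `IsExpLift.exists_unitary` assembles the homotopy. -/

namespace CStarK

/-! ### Lifting continuous families of unitaries through a homomorphism of C⋆-algebras. -/

section UnitaryLift

open scoped CStarAlgebra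

variable {R S : Type*} [CStarAlgebra R] [CStarAlgebra S]

/-- A continuous family of unitaries at distance at most `1` from the identity lifts to a continuous
family of unitaries as soon as it lifts to a continuous family of elements. -/
theorem exists_unitary_lift_of_norm_sub_one_le (f : R →⋆ₐ[ℂ] S) {X : Type*} [TopologicalSpace X]
    {G : X → R} (hG : Continuous G) (hU : ∀ x, f (G x) ∈ unitary S)
    (h1 : ∀ x, ‖f (G x) - 1‖ ≤ 1) :
    ∃ g : X → unitary R, Continuous g ∧ ∀ x, f (g x) = f (G x) := by
  -- `Real.arcsin` is constant outside `[-1, 1]`, so `F` is continuous and of modulus one for every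
  -- value of `w.re`. The self-adjoint elements below therefore need no norm bound.
  set F : ℂ → ℂ := fun w => Complex.exp (Complex.I * (Real.arcsin w.re : ℝ)) with hF
  have hFc : Continuous F := by
    have := Real.continuous_arcsin
    fun_prop
  -- This is the imaginary part of `G x`. A unitary near `1` is recovered from its imaginary part as
  -- `exp(i arcsin(Im u))`, and this formula gives a unitary for any self-adjoint argument.
  set a : X → R := fun x => (-Complex.I / 2) • (G x - star (G x)) with ha
  have hac : Continuous a := by fun_prop
  have hasa : ∀ x, IsSelfAdjoint (a x) := by
    intro x
    rw [IsSelfAdjoint, ha, star_smul, star_sub, star_star, ← neg_sub (G x), smul_neg, ← neg_smul]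
    congr 1
    simp
    ring
  have han : ∀ x, IsStarNormal (a x) := fun x => (hasa x).isStarNormal
  have hun : ∀ x, cfc F (a x) ∈ unitary R := by
    intro x
    rw [cfc_unitary_iff F (a x) (han x) hFc.continuousOn]
    intro w _
    rw [hF, Complex.star_def, ← Complex.exp_conj, ← Complex.exp_add]
    simp
  refine ⟨fun x => ⟨cfc F (a x), hun x⟩, ?_, ?_⟩
  · apply Continuous.subtype_mk
    exact Continuous.cfc_of_mem_nhdsSet F (s := Set.univ) Filter.univ_mem hac han hFc.continuousOn
  · intro x
    change f (cfc F (a x)) = f (G x)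
    set u := f (G x) with hu
    have hun : IsStarNormal u := ⟨by
      rw [Commute, SemiconjBy, Unitary.star_mul_self_of_mem (hU x),
        Unitary.mul_star_self_of_mem (hU x)]⟩
    have hfa : f (a x) = cfc (fun z : ℂ => (z.im : ℂ)) u := by
      have e1 : (fun z : ℂ => (z.im : ℂ)) = fun z => (-Complex.I / 2) • (z - star z) := by
        ext z
        apply Complex.ext <;> simp
        ring
      rw [e1, cfc_smul _ _ u (by fun_prop), cfc_sub _ _ u (by fun_prop) (by fun_prop),
        cfc_star (fun z : ℂ => z) u, cfc_id' ℂ u, ha, map_smul, map_sub, map_star]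
    have hfan : IsStarNormal (f (a x)) := by
      rw [hfa]; infer_instance
    rw [StarAlgHom.map_cfc f F (a x) hFc.continuousOn (map_continuous f) (han x) hfan, hfa,
      ← cfc_comp' F (fun z : ℂ => (z.im : ℂ)) u (hFc.continuousOn) (by fun_prop)]
    conv_rhs => rw [← cfc_id' ℂ u]
    apply cfc_congr
    intro z hz
    have hz1 : ‖z‖ = 1 := by
      have := spectrum.subset_circle_of_unitary (hU x) hz
      simpa using this
    -- This is where the bound `1` enters: it forces `Re z ≥ 1/2` on the spectrum, so the
    -- nonnegative root `√(1 - (Im z)²)` is `Re z` and not `-Re z`.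
    have hz2 : 2 * (1 - z.re) ≤ 1 := by
      refine (Unitary.two_mul_one_sub_le_norm_sub_one_sq (hU x) hz).trans ?_
      have := norm_nonneg (u - 1)
      have := h1 x
      nlinarith
    have hz3 : z.re ^ 2 + z.im ^ 2 = 1 := by
      have := Complex.sq_norm z
      rw [hz1, Complex.normSq_apply] at this
      linarith
    have him : -1 ≤ z.im ∧ z.im ≤ 1 := by constructor <;> nlinarith
    change Complex.exp (Complex.I * ((Real.arcsin ((z.im : ℂ)).re : ℝ) : ℂ)) = z
    rw [Complex.ofReal_re, mul_comm, Complex.exp_mul_I, ← Complex.ofReal_cos,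
      ← Complex.ofReal_sin, Real.sin_arcsin him.1 him.2, Real.cos_arcsin]
    have : Real.sqrt (1 - z.im ^ 2) = z.re := by
      rw [← hz3, add_sub_cancel_right, Real.sqrt_sq (by linarith)]
    rw [this]
    exact Complex.re_add_im z

/-- A continuous family of paths of unitaries starting at the identity lifts to a continuous family
of paths of unitaries starting at the identity, as soon as it lifts to a continuous family of
elements. -/
theorem exists_unitary_path_lift (f : R →⋆ₐ[ℂ] S) {Y : Type*} [TopologicalSpace Y]
    [CompactSpace Y] {G : unitInterval × Y → R} (hG : Continuous G)
    (hU : ∀ p, f (G p) ∈ unitary S) (h1 : ∀ y, f (G (0, y)) = 1) :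
    ∃ g : unitInterval × Y → unitary R, Continuous g ∧ (∀ p, f (g p) = f (G p)) ∧
      ∀ y, g (0, y) = 1 := by
  -- a mesh on which the family varies by at most `1`
  obtain ⟨δ, hδ, hvar⟩ : ∃ δ > 0, ∀ (s t : unitInterval) (y : Y), dist s t < δ →
      ‖f (G (s, y)) - f (G (t, y))‖ ≤ 1 := by
    -- Regarded as a path in `C(Y, S)` with the sup norm, the family is uniformly continuous in `s`,
    -- and this gives one mesh for all `y`. Compactness of `Y` is used here.
    have hc : Continuous fun s : unitInterval =>
        (⟨fun y => f (G (s, y)), by have := map_continuous f; fun_prop⟩ : C(Y, S)) := by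
      apply ContinuousMap.continuous_of_continuous_uncurry
      have := map_continuous f
      simp only [Function.uncurry_def, ContinuousMap.coe_mk]
      fun_prop
    have huc := CompactSpace.uniformContinuous_of_continuous hc
    obtain ⟨δ, hδ, h⟩ := Metric.uniformContinuous_iff.1 huc 1 one_pos
    refine ⟨δ, hδ, fun s t y hst => ?_⟩
    rw [← dist_eq_norm]
    exact (ContinuousMap.dist_apply_le_dist y).trans (h hst).le
  obtain ⟨N, hN⟩ := exists_nat_one_div_lt hδ
  -- truncate at time `k / (N + 1)` and lift inductively
  let c : ℕ → unitInterval → unitInterval := fun k s =>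
    ⟨min (s : ℝ) (k / (N + 1 : ℝ)), le_min s.2.1 (by positivity), (min_le_left _ _).trans s.2.2⟩
  have hcc : ∀ k, Continuous (c k) := by
    intro k
    apply Continuous.subtype_mk
    fun_prop
  have key : ∀ k : ℕ, ∃ g : unitInterval × Y → unitary R, Continuous g ∧
      ∀ p, f (g p) = f (G (c k p.1, p.2)) := by
    intro k
    induction k with
    | zero =>
      refine ⟨fun _ => 1, continuous_const, fun p => ?_⟩
      have : c 0 p.1 = 0 := by
        apply Subtype.ext
        simp only [c]
        simpa using p.1.2.1
      rw [this, h1]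
      simp
    | succ k ih =>
      obtain ⟨g, hg, hgl⟩ := ih
      have hck := hcc k
      have hck1 := hcc (k + 1)
      -- The increment between consecutive truncations has image within `1` of the identity, because
      -- the two truncated times differ by at most one mesh step. It is thus covered by the local
      -- lifting result.
      obtain ⟨m, hm, hml⟩ := exists_unitary_lift_of_norm_sub_one_le f
        (G := fun p : unitInterval × Y => G (c (k + 1) p.1, p.2) * star (G (c k p.1, p.2)))
        (by fun_prop)
        (fun p => by
          rw [map_mul, map_star]
          exact mul_mem (hU _) (Unitary.star_mem (hU _)))
        (fun p => by
          have e := Unitary.norm_sub_eq (⟨_, hU (c (k + 1) p.1, p.2)⟩ : unitary S)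
            ⟨_, hU (c k p.1, p.2)⟩
          rw [map_mul, map_star]
          refine le_of_eq_of_le e.symm (hvar _ _ _ (lt_of_le_of_lt ?_ hN))
          rw [Subtype.dist_eq, Real.dist_eq]
          have e2 : ((k + 1 : ℕ) : ℝ) / (N + 1 : ℝ) = k / (N + 1 : ℝ) + 1 / (N + 1 : ℝ) := by
            push_cast
            ring
          have e3 : (0 : ℝ) ≤ 1 / (N + 1 : ℝ) := by positivity
          change |min (p.1 : ℝ) (((k + 1 : ℕ) : ℝ) / (N + 1 : ℝ)) - min (p.1 : ℝ) (k / (N + 1 : ℝ))|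
            ≤ _
          rw [e2, abs_le]
          constructor <;>
            rcases min_cases (p.1 : ℝ) (k / (N + 1 : ℝ)) with h | h <;>
            rcases min_cases (p.1 : ℝ) (k / (N + 1 : ℝ) + 1 / (N + 1 : ℝ)) with h' | h' <;>
            linarith [h.1, h.2, h'.1, h'.2])
      refine ⟨fun p => m p * g p, by fun_prop, fun p => ?_⟩
      change f ((m p : R) * (g p : R)) = _
      rw [map_mul, hml, hgl, map_mul, map_star, mul_assoc, Unitary.star_mul_self_of_mem (hU _),
        mul_one]
  obtain ⟨g, hg, hgl⟩ := key (N + 1)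
  have hc1 : ∀ s, c (N + 1) s = s := by
    intro s
    apply Subtype.ext
    simp only [c]
    push_cast
    rw [div_self (by positivity)]
    exact min_eq_left s.2.2
  -- The lift at time zero need not be `1`, but its image is `1`, so dividing by it corrects the
  -- starting point without changing the image.
  refine ⟨fun p => g p * (g (0, p.2))⁻¹, by fun_prop, fun p => ?_, fun y => by simp⟩
  have h0 : f (star (g (0, p.2)) : R) = 1 := by
    rw [map_star, hgl, hc1, h1, star_one]
  change f ((g p : R) * star (g (0, p.2) : R)) = _
  rw [map_mul, h0, mul_one, hgl, hc1]

end UnitaryLift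

/-! ### Transfer of the lifting result to matrix algebras. -/

section MatrixLift

open scoped CStarAlgebra

variable {R S : Type*} [CStarAlgebra R] [CStarAlgebra S]

/-- The version of `exists_unitary_path_lift` for matrices. -/
theorem exists_UMat_path_lift (f : R →⋆ₐ[ℂ] S) (n : ℕ) {Y : Type*} [TopologicalSpace Y]
    [CompactSpace Y] {G : unitInterval × Y → Matrix (Fin n) (Fin n) R} (hG : Continuous G)
    (hU : ∀ p, (G p).map f ∈ unitary (Matrix (Fin n) (Fin n) S))
    (h1 : ∀ y, (G (0, y)).map f = 1) :
    ∃ g : unitInterval × Y → UMat R n, Continuous g ∧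
      (∀ p, (g p : Matrix (Fin n) (Fin n) R).map f = (G p).map f) ∧ ∀ y, g (0, y) = 1 := by
  -- The C⋆-structure on matrices comes from their action on a Hilbert module, whose definition
  -- involves positivity; the spectral orders serve only to supply it.
  let _ : PartialOrder R := CStarAlgebra.spectralOrder R
  have _ : StarOrderedRing R := CStarAlgebra.spectralOrderedRing R
  let _ : PartialOrder S := CStarAlgebra.spectralOrder S
  have _ : StarOrderedRing S := CStarAlgebra.spectralOrderedRing S
  let F : CStarMatrix (Fin n) (Fin n) R →⋆ₐ[ℂ] CStarMatrix (Fin n) (Fin n) S :=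
    { toFun := fun M => CStarMatrix.ofMatrix ((CStarMatrix.ofMatrix.symm M).map f)
      map_one' := Matrix.map_one f (map_zero f) (map_one f)
      map_mul' := fun M N => Matrix.map_mul (L := (M : Matrix _ _ R)) (M := (N : Matrix _ _ R))
        (f := f)
      map_zero' := Matrix.map_zero f (map_zero f)
      map_add' := fun M N => Matrix.map_add f (map_add f) (M : Matrix _ _ R) (N : Matrix _ _ R)
      commutes' := fun r => Matrix.map_algebraMap r f (map_zero f) (AlgHomClass.commutes f r)
      map_star' := fun M => Matrix.conjTranspose_map f (fun x => map_star f x)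
        (A := (M : Matrix _ _ R)) }
  -- The topology of the C⋆-norm on matrices is the entrywise one, so continuity passes in both
  -- directions unchanged.
  obtain ⟨g, hg, hgl, hg1⟩ := exists_unitary_path_lift F
    (G := fun p => CStarMatrix.ofMatrix (G p)) hG hU h1
  exact ⟨g, hg, hgl, hg1⟩

end MatrixLift

/-! ### Comparing the endpoints of two lifts of one path. -/

section Group

variable {G H : Type*} [Group G] [TopologicalSpace G] [IsTopologicalGroup G] [Group H]

/-- Two lifts of the same path, starting at the identity, have endpoints that are joined inside the
kernel. -/
theorem joinedIn_ker_of_path_lifts (F : G →* H) {a b : unitInterval → G} (ha : Continuous a)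
    (hb : Continuous b) (hab : ∀ s, F (a s) = F (b s)) (ha0 : a 0 = 1) (hb0 : b 0 = 1)
    (hb1 : F (b 1) = 1) : JoinedIn {U | F U = 1} (a 1) (b 1) := by
  -- The quotient of the two lifts stays in the kernel; translated by `b 1`, it runs from `b 1` to
  -- `a 1`, hence the reversal.
  refine JoinedIn.symm ⟨⟨⟨fun s => a s * (b s)⁻¹ * b 1, by fun_prop⟩, by simp [ha0, hb0],
    by simp⟩, ?_⟩
  intro s
  change F (a s * (b s)⁻¹ * b 1) = 1
  rw [map_mul, map_mul, map_inv, hab, hb1, mul_inv_cancel, mul_one]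

end Group

/-! ### The rotating family of loops of unitaries built from the relations of `qℂ`. -/

section Loop

/-- The relations satisfied by the generators `h₀`, `x₀`, `k₀` of `qℂ`. -/
structure QCRel {R : Type*} [NonUnitalRing R] [StarRing R] (h x k : R) : Prop where
  star_h : star h = h
  star_k : star k = k
  hh : h * h = h - star x * x
  kk : k * k = k - x * star x
  kx : k * x = x * h
  hk : h * k = 0
  hx : h * x = 0
  xk : x * k = 0
  xx : x * x = 0

variable {R : Type*} [Ring R] [StarRing R] [Algebra ℂ R] [StarModule ℂ R]

/-- The difference `W - E` of the projections `W` onto `√(1-t) e₁ + √t f` and `E` onto `e₁`, where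
`f = d e₂ + c e₃` in the notation of `ℂ² ⊗ ℂ²`. -/
def projDiff (h x k : R) (c d : ℂ) : Matrix (Fin 2) (Fin 2) R :=
  !![-h + d • (x + star x) + (d * d) • k, c • star x + (c * d) • k;
    c • x + (c * d) • k, (c * c) • k]

/-- The product `(W - E) E`, for the projections `W` and `E` of `projDiff`. -/
def projDiffCol (h x : R) (c d : ℂ) : Matrix (Fin 2) (Fin 2) R :=
  !![-h + d • x, 0; c • x, 0]

/-- The unitary `(1 + (z - 1) W) (1 + (z⋆ - 1) E)`, for the projections `W` and `E` of
`projDiff`. -/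
def projLoop (h x k : R) (c d z : ℂ) : Matrix (Fin 2) (Fin 2) R :=
  1 + (z - 1) • projDiff h x k c d + (2 - z - star z) • projDiffCol h x c d

variable {h x k : R}

theorem QCRel.star_projDiff (H : QCRel h x k) {c d : ℂ} (hc : star c = c) (hd : star d = d) :
    star (projDiff h x k c d) = projDiff h x k c d := by
  rw [projDiff, Matrix.star_eq_conjTranspose]
  apply Matrix.ext
  intro i j
  fin_cases i <;> fin_cases j <;>
    simp [-RCLike.star_def, H.star_h, H.star_k, star_smul, hc, hd, add_comm]

/-- With `D = W - E` and `C = DE`, these are the formal consequences of `W² = W` and `E² = E`: `D² =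
D - C - C⋆`, `DC = C⋆C = E - EWE`, and `CD = CC⋆`. In the model `E - EWE` is `t` times the
projection onto `e`, which is `h` in the corner. Since `W` and `E` themselves are unavailable over
`R`, the identities are checked entry by entry. -/
theorem QCRel.relations (H : QCRel h x k) {c d : ℂ} (hc : star c = c) (hd : star d = d)
    (hcd : c * c + d * d = 1) :
    projDiff h x k c d * projDiff h x k c d + projDiffCol h x c d + star (projDiffCol h x c d)
      = projDiff h x k c d ∧
    projDiff h x k c d * projDiffCol h x c d = !![h, 0; 0, 0] ∧
    star (projDiffCol h x c d) * projDiffCol h x c d = !![h, 0; 0, 0] ∧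
    projDiffCol h x c d * projDiff h x k c d
      = projDiffCol h x c d * star (projDiffCol h x c d) := by
  obtain ⟨h1, h2, h3, h4, h5, h6, h7, h8, h9⟩ := H
  -- The remaining products of generators are adjoints of the given relations; with them every
  -- quadratic word reduces to a normal form.
  have r1 : h * star x = star x * k := by
    have := congrArg star h5
    simpa [h1, h2] using this.symm
  have r2 : k * h = 0 := by
    have := congrArg star h6
    simpa [h1, h2] using this
  have r3 : star x * h = 0 := by
    have := congrArg star h7
    simpa [h1] using this
  have r4 : k * star x = 0 := by
    have := congrArg star h8
    simpa [h2] using this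
  have r5 : star x * star x = 0 := by
    have := congrArg star h9
    simpa using this
  have hcs : star (projDiffCol h x c d) = !![-h + d • star x, c • star x; 0, 0] := by
    rw [projDiffCol, Matrix.star_eq_conjTranspose]
    apply Matrix.ext
    intro i j
    fin_cases i <;> fin_cases j <;> simp [-RCLike.star_def, h1, star_smul, hc, hd]
  rw [hcs, projDiff, projDiffCol]
  refine ⟨?_, ?_, ?_, ?_⟩
  all_goals
    apply Matrix.ext
    intro i j
    fin_cases i <;> fin_cases j <;>
      simp only [Matrix.mul_fin_two, Matrix.add_apply, Matrix.of_apply, Matrix.cons_val',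
        Matrix.cons_val_zero, Matrix.cons_val_one, Fin.zero_eta, Fin.mk_one, Fin.isValue,
        Matrix.cons_val_fin_one, mul_add, add_mul, smul_add, smul_mul_assoc, mul_smul_comm, neg_mul,
        mul_neg, h3, h4, h5, h6, h7, h8, h9, r1, r2, r3, r4, r5, smul_zero, smul_sub, mul_zero,
        zero_mul, add_zero, zero_add, neg_zero, neg_neg]
    -- What is left is a comparison of scalar coefficients, where `c² + d² = 1` says that the
    -- rotated vector keeps length one.
    all_goals match_scalars <;> grind

end Loop

section Loop

variable {R : Type*} [Ring R] [StarRing R] [Algebra ℂ R] [StarModule ℂ R] {h x k : R}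

/-- Both products expand into words in `D`, `C` and their adjoints. The identities of
`QCRel.relations` reduce all quadratic words, and the coefficients then cancel because `|z| = 1`. -/
theorem QCRel.projLoop_mem_unitary (H : QCRel h x k) {c d z : ℂ} (hc : star c = c)
    (hd : star d = d) (hcd : c * c + d * d = 1) (hz : star z * z = 1) :
    projLoop h x k c d z ∈ unitary (Matrix (Fin 2) (Fin 2) R) := by
  obtain ⟨e1, e2, e3, e4⟩ := H.relations hc hd hcd
  have e0 := H.star_projDiff hc hd
  rw [Unitary.mem_iff, projLoop]
  set D := projDiff h x k c d
  set C := projDiffCol h x c d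
  -- This identity and the next are adjoints of `DC = C⋆C` and `CD = CC⋆`, using that `D` is
  -- self-adjoint.
  have e5 : star C * D = !![h, 0; 0, 0] := by
    rw [← e0, ← star_mul, e2, ← e3, star_mul, star_star]
  have e6 : D * star C = C * star C := by
    rw [← e0, ← star_mul, e4, star_mul, star_star]
  have e7 : D * D = D - C - star C := by
    rw [eq_sub_iff_add_eq, eq_sub_iff_add_eq, add_right_comm, e1]
  simp only [star_add, star_one, star_smul, star_sub, e0, star_star, star_ofNat]
  constructor
  · simp only [mul_add, add_mul, smul_mul_assoc, mul_smul_comm, one_mul, mul_one, e7, e2, e3, e5]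
    match_scalars <;> grind
  · simp only [mul_add, add_mul, smul_mul_assoc, mul_smul_comm, one_mul, mul_one, e7, e4, e6]
    match_scalars <;> grind

theorem projLoop_one (h x k : R) (c d : ℂ) : projLoop h x k c d 1 = 1 := by
  have : (2 : ℂ) - 1 - 1 = 0 := by norm_num
  simp [projLoop, this]

/-- The loop of `1 × 1` matrices to which `projLoop` specializes at `c = 0`, `d = 1`. -/
def cornerLoop (h x k : R) (z : ℂ) : Matrix (Fin 1) (Fin 1) R :=
  1 + !![(z - 1) • (-h + (x + star x) + k) + (2 - z - star z) • (-h + x)]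

theorem cornerLoop_one (h x k : R) : cornerLoop h x k 1 = 1 := by
  have : (2 : ℂ) - 1 - 1 = 0 := by norm_num
  simp only [cornerLoop, star_one, this, sub_self, zero_smul, add_zero]
  ext i j
  fin_cases i; fin_cases j
  simp

/-- At the end `c = 0`, `d = 1` of the rotation every entry of `D` and `C` outside the upper left
corner carries a factor `c`. The loop is then a loop of size one, padded by `1`. -/
theorem cornerMat_cornerLoop (h x k : R) (z : ℂ) :
    cornerMat (inclMat R (Fin.castLE one_le_two)) (cornerLoop h x k z)
      = projLoop h x k 0 1 z := by
  rw [cornerMat, cornerLoop, add_sub_cancel_left, projLoop, add_assoc (1 : Matrix _ _ R),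
    add_right_inj]
  apply Matrix.ext
  intro i j
  fin_cases i <;> fin_cases j <;>
    simp [Matrix.mul_apply, inclMat_apply, projDiff, projDiffCol, Fin.ext_iff]

/-- Compression by the isometry `S` recovers `y - 1` from `cornerMat S y - 1`. This yields unitarity
of the loop of size one from that of the `2 × 2` loop, with no separate computation. -/
theorem mem_unitary_of_cornerMat {ι κ : Type*} [Fintype ι] [DecidableEq ι] [Fintype κ]
    [DecidableEq κ] {S : Matrix κ ι R} (hS : Sᴴ * S = 1) {y : Matrix ι ι R}
    (hy : cornerMat S y ∈ unitary (Matrix κ κ R)) : y ∈ unitary (Matrix ι ι R) := by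
  have key : ∀ w : Matrix ι ι R, cornerMat S w = 1 → w = 1 := by
    intro w hw
    rw [cornerMat, add_eq_left] at hw
    have h2 : Sᴴ * (S * (w - 1) * Sᴴ) * S = 0 := by rw [hw]; simp
    have h3 : Sᴴ * (S * (w - 1) * Sᴴ) * S = (Sᴴ * S) * (w - 1) * (Sᴴ * S) := by
      simp only [Matrix.mul_assoc]
    rw [h3, hS, Matrix.one_mul, Matrix.mul_one] at h2
    exact sub_eq_zero.1 h2
  rw [Unitary.mem_iff, cornerMat_star, cornerMat_mul hS, cornerMat_mul hS] at hy
  exact Unitary.mem_iff.2 ⟨key _ hy.1, key _ hy.2⟩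

end Loop

/-! ### Naturality of the loops, and their source in `qℂ` and in exponentials. -/

section Map

variable {R S : Type*} [CStarAlgebra R] [CStarAlgebra S] (f : R →⋆ₐ[ℂ] S)

theorem projLoop_map (h x k : R) (c d z : ℂ) :
    (projLoop h x k c d z).map f = projLoop (f h) (f x) (f k) c d z := by
  apply Matrix.ext
  intro i j
  fin_cases i <;> fin_cases j <;>
    simp [-RCLike.star_def, projLoop, projDiff, projDiffCol, map_star]

theorem cornerLoop_map (h x k : R) (z : ℂ) :
    (cornerLoop h x k z).map f = cornerLoop (f h) (f x) (f k) z := by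
  apply Matrix.ext
  intro i j
  fin_cases i; fin_cases j
  simp [-RCLike.star_def, cornerLoop, map_star]

end Map

/-- The generators are scalar functions times `e₁₁`, `e₂₂`, `e₂₁`, so the vanishing products are
those of matrix units. They are not needed for `P₀` to be a projection; they are what leaves room
for the rotation into the corner. -/
theorem qCRel_generators : QCRel h0 x0 k0 := by
  have hk : h0 * k0 = 0 ∧ h0 * x0 = 0 ∧ x0 * k0 = 0 ∧ x0 * x0 = 0 := by
    refine ⟨?_, ?_, ?_, ?_⟩ <;>
    · apply qC.ext
      intro t
      rw [qC.eval_mul]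
      simp only [h0, k0, x0, coneElt_eval]
      ext i j
      fin_cases i <;> fin_cases j <;> simp [CStarMatrix.mul_apply] <;> rfl
  exact ⟨star_h0, star_k0, eq_sub_of_add_eq h0_rel, eq_sub_of_add_eq k0_rel, x0_rel, hk.1, hk.2.1,
    hk.2.2.1, hk.2.2.2⟩

section Exponential

variable {R : Type*} [CStarAlgebra R]

/-- At the start of the rotation `D` is `T(h, x, k) - diag(1, 0)` and `C` is its first column. The
formula follows from `(z - 1)(z̄ - 1) = 2 - z - z̄` for `|z| = 1`, without any relation among `h`,
`x`, `k`. -/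
theorem projLoop_one_zero (h x k : R) (z : ℂ) (hz : star z * z = 1) :
    projLoop h x k 1 0 z = (1 + (z - 1) • !![1 - h, star x; x, k])
      * (1 + (star z - 1) • !![1, 0; 0, 0]) := by
  apply Matrix.ext
  intro i j
  fin_cases i <;> fin_cases j <;>
    simp [-RCLike.star_def, projLoop, projDiff, projDiffCol, Matrix.mul_apply, Matrix.one_apply,
      mul_add, add_mul, smul_sub]
  all_goals
    rw [Complex.star_def] at hz
    match_scalars <;> grind

theorem continuous_expU (c : unitInterval → ℝ) (hc : Continuous c) {ι : Type*} [Fintype ι]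
    [DecidableEq ι] {a : Matrix ι ι R} (ha : IsSelfAdjoint a) :
    Continuous fun s => expU (c s) a ha := by
  apply Continuous.subtype_mk
  apply continuous_exp.comp
  fun_prop

end Exponential

/-! ### The exponential of `T(h, x, k)` and the reduction to size one. -/

section Boundary

open scoped CStarAlgebra

variable {I A B : Type*} [NonUnitalCStarAlgebra I] [NonUnitalCStarAlgebra A]
  [NonUnitalCStarAlgebra B] {ι : I →⋆ₙₐ[ℂ] A} {π : A →⋆ₙₐ[ℂ] B}

theorem QCRel.map {φ : A →⋆ₙₐ[ℂ] B} {h x k : A} (H : QCRel h x k) :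
    QCRel (φ h) (φ x) (φ k) := by
  obtain ⟨h1, h2, h3, h4, h5, h6, h7, h8, h9⟩ := H
  constructor <;> simp only [← map_star, ← map_mul, ← map_sub, *, map_zero]

theorem QCRel.inr {h x k : A} (H : QCRel h x k) :
    QCRel (h : Unitization ℂ A) (x : Unitization ℂ A) (k : Unitization ℂ A) := by
  obtain ⟨h1, h2, h3, h4, h5, h6, h7, h8, h9⟩ := H
  constructor <;> simp only [← Unitization.inr_star, ← Unitization.inr_mul, ← Unitization.inr_sub,
    *, Unitization.inr_zero]

theorem pad_map {R S : Type*} [CStarAlgebra R] [CStarAlgebra S] (f : R →⋆ₐ[ℂ] S) {n k : ℕ}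
    (h : n ≤ k) (u : UMat R n) : UMat.map f k (pad h u) = pad h (UMat.map f n u) := by
  apply Subtype.ext
  rw [UMat.map_coe, pad, pad, corner_coe, corner_coe, cornerMat_map, inclMat_map, UMat.map_coe]

/-- The exponential of the projection `T(h, x, k)` given by elements satisfying the relations of
`qℂ` is stably homotopic to a single unitary. -/
theorem IsExpLift.exists_unitary (hs : IsShortExact ι π) {h x k : B} (H : QCRel h x k)
    {W : UMat (Unitization ℂ I) 2} (hW : IsExpLift ι π (Tmat h x k) W) :
    ∃ u : unitary (Unitization ℂ I), K1Unital.mk W = K1.ofUnitary u := by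
  obtain ⟨T, hT, hTp, hWT⟩ := hW
  -- Arbitrary lifts suffice: the relations need to hold only over `B`. The polynomial formula in
  -- these lifts gives a continuous family of matrices over `Ã`, which the lifting result replaces
  -- by unitaries.
  obtain ⟨h', hh'⟩ := hs.surjective h
  obtain ⟨x', hx'⟩ := hs.surjective x
  obtain ⟨k', hk'⟩ := hs.surjective k
  set f := Unitization.starMap (R := ℂ) π with hf
  have hfh : f (h' : Unitization ℂ A) = h := by simp [hf, hh']
  have hfx : f (x' : Unitization ℂ A) = x := by simp [hf, hx']
  have hfk : f (k' : Unitization ℂ A) = k := by simp [hf, hk']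
  have H' := H.inr
  -- `z` runs once around the circle and is the loop parameter; `c` and `d` below perform the
  -- quarter turn and carry the homotopy parameter.
  let z : unitInterval → ℂ := fun s => Complex.exp ((2 * Real.pi * s : ℝ) * Complex.I)
  have hzc : Continuous z := by fun_prop
  have hz0 : z 0 = 1 := by simp [z]
  have hz1 : z 1 = 1 := by simp [z, Complex.exp_two_pi_mul_I]
  have hzz : ∀ s, star (z s) * z s = 1 := by
    intro s
    simp only [z]
    rw [Complex.star_def, ← Complex.exp_conj, ← Complex.exp_add, map_mul, Complex.conj_ofReal,
      Complex.conj_I, mul_neg, neg_add_cancel, Complex.exp_zero]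
  let c : unitInterval → ℂ := fun r => (Real.cos (Real.pi / 2 * r) : ℝ)
  let d : unitInterval → ℂ := fun r => (Real.sin (Real.pi / 2 * r) : ℝ)
  have hcc : Continuous c := by fun_prop
  have hdc : Continuous d := by fun_prop
  have hcs : ∀ r, star (c r) = c r := fun r => Complex.conj_ofReal _
  have hds : ∀ r, star (d r) = d r := fun r => Complex.conj_ofReal _
  have hcd : ∀ r, c r * c r + d r * d r = 1 := by
    intro r
    simp only [c, d]
    rw [← Complex.ofReal_mul, ← Complex.ofReal_mul, ← Complex.ofReal_add, ← sq, ← sq,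
      Real.cos_sq_add_sin_sq, Complex.ofReal_one]
  have hc0 : c 0 = 1 := by simp [c]
  have hd0 : d 0 = 0 := by simp [d]
  have hc1 : c 1 = 0 := by simp [c]
  have hd1 : d 1 = 1 := by simp [d]
  -- lift the homotopy of loops
  obtain ⟨g, hg, hgl, hg0⟩ := exists_UMat_path_lift f 2
    (G := fun p : unitInterval × unitInterval => projLoop (h' : Unitization ℂ A)
      (x' : Unitization ℂ A) (k' : Unitization ℂ A) (c p.2) (d p.2) (z p.1))
    (by unfold projLoop projDiff projDiffCol; fun_prop)
    (fun p => by
      rw [projLoop_map, hfh, hfx, hfk]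
      exact H'.projLoop_mem_unitary (hcs _) (hds _) (hcd _) (hzz _))
    (fun y => by
      simp only [hz0]
      rw [projLoop_map, projLoop_one])
  simp only [projLoop_map, hfh, hfx, hfk] at hgl
  -- lift the loop of `1 × 1` matrices
  obtain ⟨v, hv, hvl, hv0⟩ := exists_UMat_path_lift f 1 (Y := Unit)
    (G := fun p : unitInterval × Unit => cornerLoop (h' : Unitization ℂ A)
      (x' : Unitization ℂ A) (k' : Unitization ℂ A) (z p.1))
    (by unfold cornerLoop; fun_prop)
    (fun p => by
      rw [cornerLoop_map, hfh, hfx, hfk]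
      -- Unitarity in size one is read off from the `2 × 2` loop at `c = 0`, `d = 1`.
      apply mem_unitary_of_cornerMat (inclMat_isometry (Fin.castLE_injective one_le_two))
      rw [cornerMat_cornerLoop]
      exact H'.projLoop_mem_unitary (by simp) (by simp) (by simp) (hzz _))
    (fun y => by
      simp only [hz0]
      rw [cornerLoop_map, cornerLoop_one])
  simp only [cornerLoop_map, hfh, hfx, hfk] at hvl
  have hv1 : UMat.map f 1 (v (1, ())) = 1 := by
    apply Subtype.ext
    rw [UMat.map_coe, hvl]
    simp only [hz1]
    exact cornerLoop_one _ _ _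
  have hg1 : ∀ r, UMat.map f 2 (g (1, r)) = 1 := by
    intro r
    apply Subtype.ext
    rw [UMat.map_coe, hgl]
    simp only [hz1]
    exact projLoop_one _ _ _ _ _
  -- the lift of the loop at the start of the homotopy given by the exponential
  set e : Matrix (Fin 2) (Fin 2) (Unitization ℂ A) := !![1, 0; 0, 0] with he
  have hes : IsSelfAdjoint e := by
    rw [IsSelfAdjoint, Matrix.star_eq_conjTranspose]
    apply Matrix.ext
    intro i j
    fin_cases i <;> fin_cases j <;> simp [he]
  have hee : e * e = e := by
    rw [he, Matrix.mul_fin_two]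
    simp
  -- The second factor makes the image over `B̃` the loop `projLoop` at `c = 1`, `d = 0`. It costs
  -- nothing at `s = 1`: `e` is idempotent already over `Ã`, so `exp(-2πie) = 1`. In contrast `T` is
  -- only self-adjoint over `Ã`.
  let E : unitInterval → UMat (Unitization ℂ A) 2 := fun s =>
    expU (2 * Real.pi * s) T hT * expU (-(2 * Real.pi * s)) e hes
  have hE : Continuous E :=
    (continuous_expU _ (by fun_prop) hT).mul (continuous_expU _ (by fun_prop) hes)
  have hEf : ∀ s, UMat.map f 2 (E s) = UMat.map f 2 (g (s, 0)) := by
    intro s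
    apply Subtype.ext
    have hTT := (isStarProjection_Tmat H.star_h H.star_k
      (by rw [H.hh]; abel) (by rw [H.kk]; abel) H.kx).isIdempotentElem
    have e1 : (expU (2 * Real.pi * s) T hT : Matrix (Fin 2) (Fin 2) (Unitization ℂ A)).map f
        = 1 + (z s - 1) • Tmat h x k := by
      simp only [expU]
      rw [exp_map, smul_map, hTp, exp_smul_idempotent hTT]
    have e2 : (expU (-(2 * Real.pi * s)) e hes : Matrix (Fin 2) (Fin 2) (Unitization ℂ A)).map f
        = 1 + (star (z s) - 1) • !![1, 0; 0, 0] := by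
      have e3 : star (z s) = Complex.exp (((-(2 * Real.pi * s) : ℝ) : ℂ) * Complex.I) := by
        simp only [z]
        rw [Complex.star_def, ← Complex.exp_conj, map_mul, Complex.conj_ofReal, Complex.conj_I,
          Complex.ofReal_neg, neg_mul, mul_neg]
      simp only [expU]
      rw [exp_smul_idempotent hee, e3]
      apply Matrix.ext
      intro i j
      fin_cases i <;> fin_cases j <;> simp [he]
    rw [UMat.map_coe, UMat.map_coe, hgl]
    simp only [hc0, hd0]
    rw [projLoop_one_zero _ _ _ _ (hzz s), ← Unitization.inr_star]
    change ((expU (2 * Real.pi * s) T hT : Matrix (Fin 2) (Fin 2) (Unitization ℂ A))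
      * (expU (-(2 * Real.pi * s)) e hes : Matrix (Fin 2) (Fin 2) (Unitization ℂ A))).map f = _
    rw [Matrix.map_mul, e1, e2, Tmat]
  have hE0 : E 0 = 1 := by
    apply Subtype.ext
    simp [E, expU]
  have hE1 : E 1 = UMat.map (Unitization.starMap ι) 2 W := by
    apply Subtype.ext
    rw [UMat.map_coe, hWT]
    change (expU (2 * Real.pi * (1 : ℝ)) T hT : Matrix (Fin 2) (Fin 2) (Unitization ℂ A))
      * (expU (-(2 * Real.pi * (1 : ℝ))) e hes : Matrix (Fin 2) (Fin 2) (Unitization ℂ A)) = _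
    have e4 : Complex.exp (-(2 * Real.pi * Complex.I)) = 1 := by
      rw [Complex.exp_neg, Complex.exp_two_pi_mul_I, inv_one]
    simp only [expU, mul_one]
    rw [exp_smul_idempotent hee]
    simp [e4]
  -- assemble the homotopy
  have J1 := joinedIn_ker_of_path_lifts (UMat.map f 2) (b := fun s => g (s, 0)) hE (by fun_prop)
    hEf hE0 (hg0 0) (hg1 0)
  -- Each loop of the homotopy closes up at `s = 1`, so the endpoints of the lifted loops trace a
  -- path inside the kernel as the rotation parameter varies.
  have J2 : JoinedIn {U | UMat.map f 2 U = 1} (g (1, 0)) (g (1, 1)) :=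
    ⟨⟨⟨fun r => g (1, r), by fun_prop⟩, rfl, rfl⟩, hg1⟩
  -- After the rotation the loop has two lifts: the end of the lifted homotopy, and the padded lift
  -- of the loop of size one.
  have J3 := joinedIn_ker_of_path_lifts (UMat.map f 2) (a := fun s => g (s, 1))
    (b := fun s => pad one_le_two (v (s, ()))) (by fun_prop)
    ((continuous_pad one_le_two).comp (by fun_prop)) (fun s => by
      rw [pad_map]
      apply Subtype.ext
      rw [UMat.map_coe, hgl, pad, corner_coe, UMat.map_coe, hvl]
      simp only [hc1, hd1]
      rw [cornerMat_cornerLoop]) (hg0 1) (by simp [hv0])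
    (by rw [pad_map, hv1, map_one])
  -- The endpoint of the size-one lift is trivial over `B̃`, so it comes from a `1 × 1` unitary over
  -- `Ĩ`. Its only entry is the required element.
  obtain ⟨V, hV⟩ := hs.exists_unitary (v (1, ())) hv1
  have J := (J1.trans J2).trans J3
  rw [hE1, ← hV, ← pad_map] at J
  refine ⟨⟨(V : Matrix (Fin 1) (Fin 1) (Unitization ℂ I)) 0 0, ?_⟩, ?_⟩
  · have hV2 := Unitary.mem_iff.1 V.2
    rw [Unitary.mem_iff]
    have a1 := congrFun (congrFun hV2.1 0) 0
    have a2 := congrFun (congrFun hV2.2 0) 0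
    simp only [Matrix.mul_apply, Matrix.star_apply, Finset.univ_unique, Finset.sum_singleton,
      Fin.default_eq_zero, Matrix.one_apply_eq] at a1 a2
    exact ⟨a1, a2⟩
  · rw [K1Unital.mk_eq_of_joined (hs.joined J), K1Unital.mk_pad]
    congr 1
    apply Subtype.ext
    apply Matrix.ext
    intro i j
    fin_cases i; fin_cases j
    rfl

end Boundary

end CStarK

theorem mainTheorem1 {I A B : Type*} [NonUnitalCStarAlgebra I] [NonUnitalCStarAlgebra A]
    [NonUnitalCStarAlgebra B] (ι : I →⋆ₙₐ[ℂ] A) (π : A →⋆ₙₐ[ℂ] B)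
    (h : CStarK.IsShortExact ι π) (x : CStarK.K0 B)
    (hx : ∃ φ : CStarK.qC →⋆ₙₐ[ℂ] B, x = CStarK.K0.map φ CStarK.b) :
    ∃ u : unitary (Unitization ℂ I), CStarK.expMap h x = CStarK.K1.ofUnitary u := by
  open CStarK in
  obtain ⟨φ, rfl⟩ := hx
  set F := Unitization.starMap (R := ℂ) φ with hF
  have hb : ((K0.map φ b : K0 B) : K0Unital (Unitization ℂ B))
      = K0Unital.mk (P0.map F) - K0Unital.mk ((unitProj (Unitization ℂ qC)).map F) := by
    change K0Unital.map F (K0Unital.mk P0 - K0Unital.mk (unitProj (Unitization ℂ qC))) = _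
    rw [map_sub, K0Unital.map_mk, K0Unital.map_mk]
  have hP : (P0.map F).mat = Tmat (φ h0) (φ x0) (φ k0) := by
    change (Tmat h0 x0 k0).map F = _
    apply Matrix.ext
    intro i j
    have h00 : F (1 - (h0 : Unitization ℂ qC)) = 1 - (φ h0 : Unitization ℂ B) := by
      rw [map_sub, map_one]
      simp [hF]
    fin_cases i <;> fin_cases j
    · exact h00
    all_goals simp [Tmat, hF, map_star]
  have h1 : ((unitProj (Unitization ℂ qC)).map F).mat = 1 :=
    Matrix.map_one F (map_zero F) (map_one F)
  obtain ⟨W, hW⟩ := h.exists_expLift (P0.map F).isProj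
  -- The unit projection lifts to the unit, and `exp(2πi) = 1`. The subtracted class therefore
  -- vanishes, and the boundary is the class of `W` alone.
  have hW1 : IsExpLift ι π ((unitProj (Unitization ℂ qC)).map F).mat
      (1 : UMat (Unitization ℂ I) 1) := by
    refine ⟨1, IsSelfAdjoint.one _, ?_, ?_⟩
    · rw [h1]
      exact Matrix.map_one _ (map_zero _) (map_one _)
    · rw [exp_smul_idempotent (mul_one _), Complex.exp_two_pi_mul_I, sub_self, zero_smul, add_zero]
      exact Matrix.map_one _ (map_zero _) (map_one _)
  obtain ⟨u, hu⟩ := IsExpLift.exists_unitary h (qCRel_generators.map (φ := φ)) (W := W)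
    (by rw [← hP]; exact hW)
  exact ⟨u, (expMap_apply h _ _ _ hb hW hW1).trans
    ((congrArg (K1Unital.mk W - ·) (K1Unital.mk_one 1)).trans ((sub_zero _).trans hu))⟩
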